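/- **Conventions.** "Small" refers to a fixed universe. For a category $M$ with a class of maps $W$ (weak equivalences) and a small category $D$, let $M^D$ be the category of $D$-diagrams in $M$ with the pointwise weak equivalences, and let $\gamma_D\colon M^D\to \mathbf{ho}M^D$ be its (Gabriel–Zisman) localization at the pointwise weak equivalences. An *(Anderson–Brown–Cisinski) cofibration category* is a category $M$ with two classes of maps, weak equivalences $W$ and cofibrations $\mathrm{Cof}$, such that, calling $A$ cofibrant if the map $\emptyset\to A$ from the initial object is a cofibration, and calling a cofibration trivial if it is in $W$: - (CF1) $M$ has an initial object, which is cofibrant; cofibrations are closed under composition; isomorphisms are weak equivalences, and isomorphisms with cofibrant domain are cofibrations. - (CF2) If two of $f,g,gf$ are weak equivalences, so is the third. - (CF3) If $i\colon A\to B$ is a cofibration and $A\to C$ is a map with $A,C$ cofibrant, then the pushout $D=B\sqcup_A C$ exists and $C\to D$ is a cofibration, which is trivial if $i$ is trivial. - (CF4) Every map $f\colon A\to B$ with $A$ cofibrant factors as $f=rf'$ with $f'$ a cofibration and $r$ a weak equivalence. - (CF5) If $f_i\colon A_i\to B_i$ $(i\in I)$ is a small set of cofibrations with all $A_i$ cofibrant,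 then $\coprod A_i$ and $\coprod B_i$ exist and are cofibrant, and $\coprod f_i$ is a cofibration, which is trivial if all $f_i$ are trivial. - (CF6) For every sequence of cofibrations $A_0\to A_1\to A_2\to\cdots$ with $A_0$ cofibrant, $\operatorname{colim}A_n$ exists and $A_0\to\operatorname{colim}A_n$ is a cofibration, which is trivial if all $A_n\to A_{n+1}$ are trivial. A *fibration category* $(M,W,\mathrm{Fib})$ is defined by the dual axioms. Let $u\colon D_1\to D_2$ be a functor of small categories, $u^*\colon M^{D_2}\to M^{D_1}$ the restriction functor, and $\mathbf{ho}u^*\colon\mathbf{ho}M^{D_2}\to\mathbf{ho}M^{D_1}$ the functor with $\mathbf{ho}u^*\circ\gamma_{D_2}=\gamma_{D_1}\circ u^*$. Let $i\colon M^{D_1}_{\operatorname{colim}^u}\hookrightarrow M^{D_1}$ be the full subcategory of those $X$ for which $\operatorname{colim}^uX$ exists, i.e. for which the functor $Y\mapsto\operatorname{Hom}(X,u^*Y)$ on $M^{D_2}$ is corepresented by an object $\operatorname{colim}^uX$, with universal map $\eta_X\colon X\to u^*\operatorname{colim}^uX$; this gives a functor $\operatorname{colim}^u\colon M^{D_1}_{\operatorname{colim}^u}\to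 M^{D_2}$. Dually define $i\colon M^{D_1}_{\lim^u}\hookrightarrow M^{D_1}$, $\lim^u\colon M^{D_1}_{\lim^u}\to M^{D_2}$ and $\theta_X\colon u^*\lim^uX\to X$. A *homotopy colimit* of $u$ is a pair $(\mathbf L\operatorname{colim}^u,\epsilon_u)$ of a functor $\mathbf L\operatorname{colim}^u\colon\mathbf{ho}M^{D_1}\to\mathbf{ho}M^{D_2}$ and a natural map $\epsilon_u\colon\mathbf L\operatorname{colim}^u\circ\gamma_{D_1}i\Rightarrow\gamma_{D_2}\operatorname{colim}^u$ such that for every pair $(\Lambda,\lambda)$ of a functor $\Lambda\colon\mathbf{ho}M^{D_1}\to\mathbf{ho}M^{D_2}$ and a natural map $\lambda\colon\Lambda\circ\gamma_{D_1}i\Rightarrow\gamma_{D_2}\operatorname{colim}^u$ there is a unique $\delta\colon\Lambda\Rightarrow\mathbf L\operatorname{colim}^u$ with $\epsilon_u\circ(\delta\,\gamma_{D_1}i)=\lambda$. A *homotopy limit* of $u$ is a pair $(\mathbf R\lim^u,\nu_u)$ with $\nu_u\colon\gamma_{D_2}\lim^u\Rightarrow\mathbf R\lim^u\circ\gamma_{D_1}i$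 having the dual (initial) universal property. **Theorem (Existence of homotopy (co)limits).** Let $u\colon D_1\to D_2$ be a functor of small categories. 1. If $M$ is a cofibration category, then the homotopy colimit $(\mathbf L\operatorname{colim}^u,\epsilon_u)$ exists, and $$\mathbf L\operatorname{colim}^u\colon\mathbf{ho}M^{D_1}\rightleftarrows\mathbf{ho}M^{D_2}\colon\mathbf{ho}u^*$$ is naturally an adjoint pair: there is an adjunction $\mathbf L\operatorname{colim}^u\dashv\mathbf{ho}u^*$ whose unit $\Phi$ satisfies $\mathbf{ho}u^*(\epsilon_{u,X})\circ\Phi_{\gamma_{D_1}X}=\gamma_{D_1}(\eta_X)$ for all $X\in M^{D_1}_{\operatorname{colim}^u}$. 2. If $M$ is a fibration category, then the homotopy limit $(\mathbf R\lim^u,\nu_u)$ exists, and $$\mathbf{ho}u^*\colon\mathbf{ho}M^{D_2}\rightleftarrows\mathbf{ho}M^{D_1}\colon\mathbf R\lim^u$$ is naturally an adjoint pair: there is an adjunction $\mathbf{ho}u^*\dashv\mathbf R\lim^u$ whose counit $\Psi$ satisfies $\Psi_{\gamma_{D_1}X}\circ\mathbf{ho}u^*(\nu_{u,X})=\gamma_{D_1}(\theta_X)$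 for all $X\in M^{D_1}_{\lim^u}$. -/

import Mathlib

open CategoryTheory CategoryTheory.Limits

universe w v u

namespace ABC

section Axioms

variable {M : Type u} [Category.{v} M]

/-- An object `A` is cofibrant if the map `∅ ⟶ A` from an initial object is a cofibration.
(Under the axioms below this does not depend on the initial object.) -/
def IsCofibrant (Cof : MorphismProperty M) (A : M) : Prop :=
  ∃ (I : M) (hI : IsInitial I), Cof (hI.to A)

/-- An object `A` is fibrant if the map `A ⟶ *` to a terminal object is a fibration. -/
def IsFibrant (Fib : MorphismProperty M) (A : M) : Prop :=
  ∃ (T : M) (hT : IsTerminal T), Fib (hT.from A)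

/-- Anderson-Brown-Cisinski cofibration categories `(M, W, Cof)`: axioms CF1-CF6.
The universe `w` is the universe of small sets. -/
structure IsCofibrationCategory (W Cof : MorphismProperty M) : Prop where
  /-- CF1: there is an initial object, and it is cofibrant. -/
  exists_initial : ∃ I : M, Nonempty (IsInitial I) ∧ IsCofibrant Cof I
  /-- CF1: cofibrations are stable under composition. -/
  cof_comp : ∀ {A B C : M} (f : A ⟶ B) (g : B ⟶ C), Cof f → Cof g → Cof (f ≫ g)
  /-- CF1: isomorphisms are weak equivalences. -/
  weq_of_isIso : ∀ {A B : M} (f : A ⟶ B), IsIso f → W f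
  /-- CF1: isomorphisms with cofibrant domain are (trivial) cofibrations. -/
  cof_of_isIso : ∀ {A B : M} (f : A ⟶ B), IsIso f → IsCofibrant Cof A → Cof f
  /-- CF2: two out of three. -/
  two_out_of_three : W.HasTwoOutOfThreeProperty
  /-- CF3, existence of pushouts. -/
  hasPushout : ∀ {A B C : M} (i : A ⟶ B) (g : A ⟶ C), Cof i → IsCofibrant Cof A →
    IsCofibrant Cof C → HasPushout i g
  /-- CF3 (1). -/
  cof_pushout : ∀ {A B C D : M} (i : A ⟶ B) (g : A ⟶ C) (k : B ⟶ D) (j : C ⟶ D),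
    Cof i → IsCofibrant Cof A → IsCofibrant Cof C → IsPushout i g k j → Cof j
  /-- CF3 (2). -/
  weq_pushout : ∀ {A B C D : M} (i : A ⟶ B) (g : A ⟶ C) (k : B ⟶ D) (j : C ⟶ D),
    Cof i → W i → IsCofibrant Cof A → IsCofibrant Cof C → IsPushout i g k j → W j
  /-- CF4: factorization. -/
  factorization : ∀ {A B : M} (f : A ⟶ B), IsCofibrant Cof A →
    ∃ (X : M) (f' : A ⟶ X) (r : X ⟶ B), Cof f' ∧ W r ∧ f' ≫ r = f
  /-- CF5: small sums of (trivial) cofibrations with cofibrant domain. -/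
  coproduct : ∀ {I : Type w} (A B : I → M) (f : ∀ i, A i ⟶ B i),
    (∀ i, IsCofibrant Cof (A i)) → (∀ i, Cof (f i)) →
    ∃ (_ : HasCoproduct A) (_ : HasCoproduct B),
      IsCofibrant Cof (∐ A) ∧ IsCofibrant Cof (∐ B) ∧ Cof (Limits.Sigma.map f) ∧
        ((∀ i, W (f i)) → W (Limits.Sigma.map f))
  /-- CF6: countable direct compositions of (trivial) cofibrations with cofibrant domain. -/
  sequence : ∀ A : ℕ ⥤ M, IsCofibrant Cof (A.obj 0) →
    (∀ n : ℕ, Cof (A.map (homOfLE n.le_succ))) →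
    ∃ _ : HasColimit A, Cof (colimit.ι A 0) ∧
      ((∀ n : ℕ, W (A.map (homOfLE n.le_succ))) → W (colimit.ι A 0))

/-- Anderson-Brown-Cisinski fibration categories `(M, W, Fib)`: axioms F1-F6.
The universe `w` is the universe of small sets. -/
structure IsFibrationCategory (W Fib : MorphismProperty M) : Prop where
  /-- F1: there is a terminal object, and it is fibrant. -/
  exists_terminal : ∃ T : M, Nonempty (IsTerminal T) ∧ IsFibrant Fib T
  /-- F1: fibrations are stable under composition. -/
  fib_comp : ∀ {A B C : M} (f : A ⟶ B) (g : B ⟶ C), Fib f → Fib g → Fib (f ≫ g)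
  /-- F1: isomorphisms are weak equivalences. -/
  weq_of_isIso : ∀ {A B : M} (f : A ⟶ B), IsIso f → W f
  /-- F1: isomorphisms with fibrant codomain are (trivial) fibrations. -/
  fib_of_isIso : ∀ {A B : M} (f : A ⟶ B), IsIso f → IsFibrant Fib B → Fib f
  /-- F2: two out of three. -/
  two_out_of_three : W.HasTwoOutOfThreeProperty
  /-- F3, existence of pullbacks. -/
  hasPullback : ∀ {A B C : M} (p : B ⟶ A) (g : C ⟶ A), Fib p → IsFibrant Fib A →
    IsFibrant Fib C → HasPullback p g
  /-- F3 (1). -/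
  fib_pullback : ∀ {A B C D : M} (p : B ⟶ A) (g : C ⟶ A) (k : D ⟶ B) (q : D ⟶ C),
    Fib p → IsFibrant Fib A → IsFibrant Fib C → IsPullback k q p g → Fib q
  /-- F3 (2). -/
  weq_pullback : ∀ {A B C D : M} (p : B ⟶ A) (g : C ⟶ A) (k : D ⟶ B) (q : D ⟶ C),
    Fib p → W p → IsFibrant Fib A → IsFibrant Fib C → IsPullback k q p g → W q
  /-- F4: factorization. -/
  factorization : ∀ {A B : M} (f : A ⟶ B), IsFibrant Fib B →
    ∃ (X : M) (s : A ⟶ X) (f' : X ⟶ B), W s ∧ Fib f' ∧ s ≫ f' = f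
  /-- F5: small products of (trivial) fibrations with fibrant codomain. -/
  product : ∀ {I : Type w} (A B : I → M) (f : ∀ i, A i ⟶ B i),
    (∀ i, IsFibrant Fib (B i)) → (∀ i, Fib (f i)) →
    ∃ (_ : HasProduct A) (_ : HasProduct B),
      IsFibrant Fib (∏ᶜ A) ∧ IsFibrant Fib (∏ᶜ B) ∧ Fib (Limits.Pi.map f) ∧
        ((∀ i, W (f i)) → W (Limits.Pi.map f))
  /-- F6: countable inverse compositions of (trivial) fibrations with fibrant codomain. -/
  sequence : ∀ A : ℕᵒᵖ ⥤ M, IsFibrant Fib (A.obj (Opposite.op 0)) →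
    (∀ n : ℕ, Fib (A.map (homOfLE n.le_succ).op)) →
    ∃ _ : HasLimit A, Fib (limit.π A (Opposite.op 0)) ∧
      ((∀ n : ℕ, W (A.map (homOfLE n.le_succ).op)) → W (limit.π A (Opposite.op 0)))

end Axioms

noncomputable section

variable {M : Type u} [Category.{v} M] (W : MorphismProperty M)

/-- `ho M^D`: the Gabriel-Zisman localization of the category of `D`-diagrams at the
pointwise weak equivalences. -/
abbrev Ho (D : Type w) [SmallCategory D] : Type _ := (W.functorCategory D).Localization

/-- The localization functor `γ_D : M^D ⥤ ho M^D`. -/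
abbrev γ (D : Type w) [SmallCategory D] : (D ⥤ M) ⥤ Ho W D := (W.functorCategory D).Q

variable (M) in
/-- The restriction functor `u^* : M^{D₂} ⥤ M^{D₁}`. -/
abbrev res {D₁ D₂ : Type w} [SmallCategory D₁] [SmallCategory D₂] (u : D₁ ⥤ D₂) :
    (D₂ ⥤ M) ⥤ (D₁ ⥤ M) :=
  (Functor.whiskeringLeft D₁ D₂ M).obj u

variable {D₁ D₂ : Type w} [SmallCategory D₁] [SmallCategory D₂] (u : D₁ ⥤ D₂)

/-- `ho u^* : ho M^{D₂} ⥤ ho M^{D₁}`, the unique functor with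
`γ_{D₂} ⋙ ho u^* = u^* ⋙ γ_{D₁}`. -/
def hoRes : Ho W D₂ ⥤ Ho W D₁ :=
  Localization.Construction.lift (res M u ⋙ γ W D₁) fun _ _ f hf =>
    Localization.inverts (γ W D₁) (W.functorCategory D₁) ((res M u).map f) fun d => hf (u.obj d)

lemma γ_comp_hoRes : γ W D₂ ⋙ hoRes W u = res M u ⋙ γ W D₁ :=
  Localization.Construction.fac _ _

/-- The canonical isomorphism (in fact an identity) `u^* ⋙ γ_{D₁} ≅ γ_{D₂} ⋙ ho u^*`. -/
def resIso : res M u ⋙ γ W D₁ ≅ γ W D₂ ⋙ hoRes W u :=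
  eqToIso (γ_comp_hoRes W u).symm

variable (M)

/-- The full subcategory `M^{D₁}_{colim^u}` of those `D₁`-diagrams `X` for which `colim^u X`
exists, i.e. for which the functor `Y ↦ Hom(X, u^* Y)` on `M^{D₂}` is corepresentable. -/
abbrev ColimDomain := (res M u).PartialLeftAdjointSource

/-- The inclusion `M^{D₁}_{colim^u} ⥤ M^{D₁}`. -/
abbrev iColim : ColimDomain M u ⥤ (D₁ ⥤ M) := (res M u).leftAdjointObjIsDefined.ι

/-- The functor `colim^u : M^{D₁}_{colim^u} ⥤ M^{D₂}`: the partial left adjoint of `u^*`. -/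
abbrev colimAlong : ColimDomain M u ⥤ (D₂ ⥤ M) := (res M u).partialLeftAdjoint

/-- The full subcategory `M^{D₁}_{lim^u}` of those `D₁`-diagrams `X` for which `lim^u X`
exists, i.e. for which the functor `Y ↦ Hom(u^* Y, X)` on `M^{D₂}` is representable. -/
abbrev LimDomain := (res M u).PartialRightAdjointSource

/-- The inclusion `M^{D₁}_{lim^u} ⥤ M^{D₁}`. -/
abbrev iLim : LimDomain M u ⥤ (D₁ ⥤ M) := (res M u).rightAdjointObjIsDefined.ι

/-- The functor `lim^u : M^{D₁}_{lim^u} ⥤ M^{D₂}`: the partial right adjoint of `u^*`. -/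
abbrev limAlong : LimDomain M u ⥤ (D₂ ⥤ M) := (res M u).partialRightAdjoint

variable {M}

/-- The universal map `X ⟶ u^* (colim^u X)`. -/
def colimUnit (X : ColimDomain M u) :
    (iColim M u).obj X ⟶ (res M u).obj ((colimAlong M u).obj X) :=
  (res M u).partialLeftAdjointHomEquiv (𝟙 _)

/-- The universal map `u^* (lim^u X) ⟶ X`. -/
def limCounit (X : LimDomain M u) :
    (res M u).obj ((limAlong M u).obj X) ⟶ (iLim M u).obj X :=
  (res M u).partialRightAdjointHomEquiv (𝟙 _)

/-- `(L, ε)` is the homotopy colimit of `u`, i.e. the left derived functor of `colim^u`: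
`ε : L ∘ (γ_{D₁} ∘ i) ⟶ γ_{D₂} ∘ colim^u` is terminal among all such pairs. Such pairs are
called left Kan extensions in the literature on derived functors
and *right* Kan extensions in Mathlib. -/
def IsHomotopyColimit (L : Ho W D₁ ⥤ Ho W D₂)
    (ε : (iColim M u ⋙ γ W D₁) ⋙ L ⟶ colimAlong M u ⋙ γ W D₂) : Prop :=
  L.IsRightKanExtension ε

/-- `(R, ν)` is the homotopy limit of `u`, i.e. the right derived functor of `lim^u`:
`ν : γ_{D₂} ∘ lim^u ⟶ R ∘ (γ_{D₁} ∘ i)` is initial among all such pairs. Such pairs are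
called right Kan extensions in the literature on derived functors
and *left* Kan extensions in Mathlib. -/
def IsHomotopyLimit (R : Ho W D₁ ⥤ Ho W D₂)
    (ν : limAlong M u ⋙ γ W D₂ ⟶ (iLim M u ⋙ γ W D₁) ⋙ R) : Prop :=
  R.IsLeftKanExtension ν

end

end ABC

/-! Diagram categories over a cofibration category carry no lifting axioms, and `colim^u` is only
partially defined. The substitute for cofibrant diagrams is the class of cellular diagrams. They are
built from an initial diagram by free cells, where a cofibration `A ⟶ B` with `A` cofibrant, placed
at `d`, contributes at `e` its copies indexed by the maps `d ⟶ e`. Pushouts, compositions and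
sequential compositions are allowed, so CF3, CF5 and CF6 make every cellular map a pointwise
cofibration, and a pointwise trivial one if all its cells are trivial (`cell_app`).

Three facts about cellular maps carry the proof. Maps out of pointwise cofibrant diagrams factor as
a cellular map followed by a pointwise weak equivalence (`exists_cell_factorization`). Cellular maps
lift against pointwise weak equivalences once the source of the latter is enlarged by a trivial
cellular map (`exists_lift`). Left Kan extension along `u` sends a cell at `d` to the same cell at
`u d`, so it exists on cellular diagrams and keeps trivial cells trivial (`exists_extension`).

The first two facts make cellular diagrams a resolving class: each diagram has a cellular
resolution, unique up to a homotopy that is invisible in any functor inverting weak equivalences.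
The third, with a form of Ken Brown's lemma (`isIso_of_inverts_trivial`), shows that `colim^u`
followed by localization inverts all weak equivalences between cellular diagrams. A formal argument
(`exists_derived_adjunction`) then yields a functor on the homotopy category, its universal
property, and the adjunction, whose unit and counit are computed on resolutions. Any other homotopy
colimit is uniquely isomorphic to this one and inherits the adjunction.

The limit statement is the colimit statement for `Mᵒᵖ` and `u.op`. To make this usable, the colimit
theorem `exists_homotopyColimit` is proved for arbitrary models of the localizations and of the
domain of `colim^u`. -/

namespace ABC

/-! ### Resolving classes and extension of functors from them -/

section Resolving

variable {C : Type*} [Category* C] {H : Type*} [Category* H]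

/-- A class of objects `K` is resolving for the weak equivalences `W` if every object admits a weak
equivalence from an object of `K`, and if these resolutions are unique up to homotopy, in the
sense that maps into the target of a resolution can be dominated by a further resolution. -/
structure IsResolving (W : MorphismProperty C) (K : ObjectProperty C) : Prop where
  exists_resolution : ∀ X : C, ∃ (P : C) (q : P ⟶ X), K P ∧ W q
  exists_cospan : ∀ {P P' X : C} (a : P ⟶ X) (b : P' ⟶ X), K P → K P' → W b →
    ∃ (Z : C) (i : P ⟶ Z) (j : P' ⟶ Z) (r : Z ⟶ X), K Z ∧ W r ∧ i ≫ r = a ∧ j ≫ r = b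
  exists_cylinder : ∀ {P Z Y : C} (a b : P ⟶ Z) (r : Z ⟶ Y), K P → K Z → W r → a ≫ r = b ≫ r →
    ∃ (I Z' : C) (i₀ i₁ : P ⟶ I) (s : I ⟶ P) (z : Z ⟶ Z') (c : I ⟶ Z'),
      K I ∧ K Z' ∧ W s ∧ W z ∧ i₀ ≫ s = 𝟙 P ∧ i₁ ≫ s = 𝟙 P ∧ i₀ ≫ c = a ≫ z ∧ i₁ ≫ c = b ≫ z

namespace IsResolving

variable {W : MorphismProperty C} {K : ObjectProperty C} (hK : IsResolving W K)

include hK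

/-- Natural transformations between functors inverting weak equivalences are determined by their
restrictions to a resolving class. -/
lemma natTrans_ext {A B : C ⥤ H} (hA : W.IsInvertedBy A) {σ σ' : A ⟶ B}
    (h : ∀ P, K P → σ.app P = σ'.app P) : σ = σ' := by
  ext X
  obtain ⟨P, q, hP, hq⟩ := hK.exists_resolution X
  have := hA q hq
  rw [← cancel_epi (A.map q), σ.naturality, σ'.naturality, h P hP]

/-- Natural transformations between functors inverting weak equivalences extend from a resolving
class. -/
lemma exists_natTrans [W.HasTwoOutOfThreeProperty] {A B : C ⥤ H} (hA : W.IsInvertedBy A)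
    (τ : K.ι ⋙ A ⟶ K.ι ⋙ B) : ∃ σ : A ⟶ B, ∀ P : K.FullSubcategory, σ.app P.obj = τ.app P := by
  choose P q hP hq using hK.exists_resolution
  have := fun X => hA (q X) (hq X)
  -- Naturality along the chosen resolution `q X` forces this value.
  let s (X : C) : A.obj X ⟶ B.obj X := inv (A.map (q X)) ≫ τ.app ⟨P X, hP X⟩ ≫ B.map (q X)
  have τnat {X Y : C} (hX : K X) (hY : K Y) (f : X ⟶ Y) :
      A.map f ≫ τ.app ⟨Y, hY⟩ = τ.app ⟨X, hX⟩ ≫ B.map f :=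
    τ.naturality (K.homMk f : (⟨X, hX⟩ : K.FullSubcategory) ⟶ ⟨Y, hY⟩)
  -- The value does not depend on the resolution: a cospan over `X` dominates both `a` and `q X`,
  -- and its leg `j` is a weak equivalence by two out of three.
  have key {X R : C} (hR : K R) (a : R ⟶ X) : A.map a ≫ s X = τ.app ⟨R, hR⟩ ≫ B.map a := by
    obtain ⟨Z, i, j, r, hZ, hr, rfl, hj⟩ := hK.exists_cospan a (q X) hR (hP X) (hq X)
    have hjW : W j := W.of_postcomp j r hr (by rw [hj]; exact hq X)
    have := hA j hjW
    have h : A.map r ≫ s X = τ.app ⟨Z, hZ⟩ ≫ B.map r := by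
      rw [← cancel_epi (A.map j), ← A.map_comp_assoc, hj]
      simp only [s, IsIso.hom_inv_id_assoc]
      rw [← Category.assoc, τnat (hP X), Category.assoc, ← B.map_comp, hj]
    rw [A.map_comp, Category.assoc, h, ← Category.assoc, τnat hR, Category.assoc, ← B.map_comp]
  refine ⟨{ app := s, naturality := fun X Y f => ?_ }, fun R => ?_⟩
  · rw [← cancel_epi (A.map (q X)), ← A.map_comp_assoc, key (hP X), ← Category.assoc,
      key (hP X), Category.assoc, B.map_comp]
  · simpa using key R.property (𝟙 _)

/-- Functors inverting weak equivalences extend from a resolving class. -/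
lemma exists_functor [W.HasTwoOutOfThreeProperty] (T : K.FullSubcategory ⥤ H)
    (hT : ∀ {P P' : K.FullSubcategory} (f : P ⟶ P'), W f.hom → IsIso (T.map f)) :
    ∃ R : C ⥤ H, W.IsInvertedBy R ∧ Nonempty (K.ι ⋙ R ≅ T) := by
  choose P q hP hq using hK.exists_resolution
  let O (X : C) : K.FullSubcategory := ⟨P X, hP X⟩
  -- `T` cannot separate homotopic maps: both ends of the cylinder are sections of the weak
  -- equivalence `s`, so `T` identifies them.
  have homot {R Z : K.FullSubcategory} {Y : C} (a b : R ⟶ Z) (r : Z.obj ⟶ Y) (hr : W r)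
      (h : a.hom ≫ r = b.hom ≫ r) : T.map a = T.map b := by
    obtain ⟨I, Z', i₀, i₁, s, z, c, hI, hZ', hs, hz, h₀, h₁, h₀', h₁'⟩ :=
      hK.exists_cylinder a.hom b.hom r R.property Z.property hr h
    let I' : K.FullSubcategory := ⟨I, hI⟩
    let Z'' : K.FullSubcategory := ⟨Z', hZ'⟩
    let i₀' : R ⟶ I' := K.homMk i₀
    let i₁' : R ⟶ I' := K.homMk i₁
    let s' : I' ⟶ R := K.homMk s
    let z' : Z ⟶ Z'' := K.homMk z
    let c' : I' ⟶ Z'' := K.homMk c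
    have := hT s' hs
    have := hT z' hz
    have e : T.map i₀' = T.map i₁' := by
      rw [← cancel_mono (T.map s'), ← T.map_comp, ← T.map_comp]
      congr 1
      ext
      exact h₀.trans h₁.symm
    rw [← cancel_mono (T.map z'), ← T.map_comp, ← T.map_comp,
      show a ≫ z' = i₀' ≫ c' by ext; exact h₀'.symm,
      show b ≫ z' = i₁' ≫ c' by ext; exact h₁'.symm, T.map_comp, T.map_comp, e]
  -- `m` plays the role of `a` followed by the formal inverse of `q Y`. Any two cospans computing it
  -- are compared inside a third, where the two composites agree by `homot`.
  have ex (R : K.FullSubcategory) (Y : C) (a : R.obj ⟶ Y) :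
      ∃ m : T.obj R ⟶ T.obj (O Y), ∀ (Z : K.FullSubcategory) (i : R ⟶ Z) (j : O Y ⟶ Z)
        (r : Z.obj ⟶ Y), W r → i.hom ≫ r = a → j.hom ≫ r = q Y → m ≫ T.map j = T.map i := by
    obtain ⟨Z, i, j, r, hZ, hr, hi, hj⟩ := hK.exists_cospan a (q Y) R.property (hP Y) (hq Y)
    let Z₁ : K.FullSubcategory := ⟨Z, hZ⟩
    let i₁ : R ⟶ Z₁ := K.homMk i
    let j₁ : O Y ⟶ Z₁ := K.homMk j
    have := hT j₁ (W.of_postcomp j r hr (by rw [hj]; exact hq Y))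
    refine ⟨T.map i₁ ≫ inv (T.map j₁), fun Z' i' j' r' hr' hi' hj' => ?_⟩
    obtain ⟨Z'', k, k', r'', hZ'', hr'', hk, hk'⟩ :=
      hK.exists_cospan r r' hZ Z'.property hr'
    let Z₂ : K.FullSubcategory := ⟨Z'', hZ''⟩
    let k₁ : Z₁ ⟶ Z₂ := K.homMk k
    let k₂ : Z' ⟶ Z₂ := K.homMk k'
    have := hT k₂ (W.of_postcomp k' r'' hr'' (by rw [hk']; exact hr'))
    have ej : T.map j' ≫ T.map k₂ = T.map j₁ ≫ T.map k₁ := by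
      rw [← T.map_comp, ← T.map_comp]
      refine homot _ _ r'' hr'' ?_
      change (j'.hom ≫ k') ≫ r'' = (j ≫ k) ≫ r''
      simp only [Category.assoc, hk, hk', hj, hj']
    have ei : T.map i' ≫ T.map k₂ = T.map i₁ ≫ T.map k₁ := by
      rw [← T.map_comp, ← T.map_comp]
      refine homot _ _ r'' hr'' ?_
      change (i'.hom ≫ k') ≫ r'' = (i ≫ k) ≫ r''
      simp only [Category.assoc, hk, hk', hi, hi']
    rw [← cancel_mono (T.map k₂), Category.assoc, Category.assoc, ej, ei, IsIso.inv_hom_id_assoc]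
  choose m hm using ex
  have cosp {R : K.FullSubcategory} {Y : C} (a : R.obj ⟶ Y) :
      ∃ (Z : K.FullSubcategory) (i : R ⟶ Z) (j : O Y ⟶ Z) (r : Z.obj ⟶ Y),
        W r ∧ i.hom ≫ r = a ∧ j.hom ≫ r = q Y := by
    obtain ⟨Z, i, j, r, hZ, hr, hi, hj⟩ := hK.exists_cospan a (q Y) R.property (hP Y) (hq Y)
    exact ⟨⟨Z, hZ⟩, K.homMk i, K.homMk j, r, hr, hi, hj⟩
  have mono {Y : C} {Z : K.FullSubcategory} (j : O Y ⟶ Z) (r : Z.obj ⟶ Y) (hr : W r)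
      (hj : j.hom ≫ r = q Y) : IsIso (T.map j) :=
    hT j (W.of_postcomp j.hom r hr (by rw [hj]; exact hq Y))
  have pre {R R' : K.FullSubcategory} (f : R ⟶ R') {Y : C} (a : R'.obj ⟶ Y) :
      m R Y (f.hom ≫ a) = T.map f ≫ m R' Y a := by
    obtain ⟨Z, i, j, r, hr, hi, hj⟩ := cosp a
    have := mono j r hr hj
    rw [← cancel_mono (T.map j), Category.assoc, hm R' Y a Z i j r hr hi hj, ← T.map_comp]
    exact hm R Y _ Z (f ≫ i) j r hr (by simp [hi]) hj
  -- Both `a` and `q Y` factor through the apex of one cospan, so `pre` reduces both sides to the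
  -- same map out of that apex.
  have post {R : K.FullSubcategory} {Y Y' : C} (a : R.obj ⟶ Y) (f : Y ⟶ Y') :
      m R Y' (a ≫ f) = m R Y a ≫ m (O Y) Y' (q Y ≫ f) := by
    obtain ⟨Z, i, j, r, hr, hi, hj⟩ := cosp a
    have := mono j r hr hj
    have h₁ := pre i (r ≫ f)
    have h₂ := pre j (r ≫ f)
    rw [← Category.assoc, hi] at h₁
    rw [← Category.assoc, hj] at h₂
    rw [h₁, h₂, ← Category.assoc, hm R Y a Z i j r hr hi hj]
  have one (Y : C) : m (O Y) Y (q Y) = 𝟙 _ := by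
    simpa using hm (O Y) Y (q Y) (O Y) (𝟙 _) (𝟙 _) (q Y) (hq Y) (by simp) (by simp)
  have iso {R : K.FullSubcategory} {Y : C} (a : R.obj ⟶ Y) (ha : W a) : IsIso (m R Y a) := by
    obtain ⟨Z, i, j, r, hr, hi, hj⟩ := cosp a
    have := mono j r hr hj
    have := hT i (W.of_postcomp i.hom r hr (by rw [hi]; exact ha))
    have h := hm R Y a Z i j r hr hi hj
    rw [← IsIso.eq_comp_inv] at h
    rw [h]
    infer_instance
  refine ⟨{ obj := fun X => T.obj (O X)
            map := fun {X Y} f => m (O X) Y (q X ≫ f)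
            map_id := fun X => by rw [Category.comp_id, one]
            map_comp := fun {X Y Z} f g => by rw [← post, Category.assoc] }, ?_, ⟨?_⟩⟩
  · intro X Y f hf
    exact iso (R := O X) (q X ≫ f) (W.comp_mem _ _ (hq X) hf)
  · have hid (R : K.FullSubcategory) : IsIso (m R R.obj (𝟙 R.obj)) :=
      iso _ (W.of_precomp (q R.obj) _ (hq _) (by rw [Category.comp_id]; exact hq _))
    refine (NatIso.ofComponents (fun R => asIso (m R R.obj (𝟙 R.obj))) fun {R R'} f => ?_).symm
    dsimp
    rw [← pre, ← post]
    simp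

end IsResolving

end Resolving

/-! ### Derived functors of partial left adjoints -/

section DerivedAdjunction

variable {C₀ C₁ C₂ H₁ H₂ : Type*} [Category* C₀] [Category* C₁] [Category* C₂] [Category* H₁]
  [Category* H₂] {W₁ : MorphismProperty C₁}
  {K : ObjectProperty C₁}

/-- Natural transformations between functors on a localization are determined by their
restrictions to a resolving class. -/
lemma IsResolving.localization_natTrans_ext (hK : IsResolving W₁ K) (Q : C₁ ⥤ H₁)
    [Q.IsLocalization W₁] {A B : H₁ ⥤ H₂} {σ σ' : A ⟶ B}
    (h : ∀ P, K P → σ.app (Q.obj P) = σ'.app (Q.obj P)) : σ = σ' := by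
  have hA : W₁.IsInvertedBy (Q ⋙ A) := fun X Y f hf => by
    have := Localization.inverts Q W₁ f hf
    dsimp
    infer_instance
  have := hK.natTrans_ext hA (σ := Functor.whiskerLeft Q σ) (σ' := Functor.whiskerLeft Q σ') h
  exact Localization.natTrans_ext Q W₁ fun X => NatTrans.congr_app this X

/-- Natural transformations between functors on a localization extend from a resolving class. -/
lemma IsResolving.exists_localization_natTrans [W₁.HasTwoOutOfThreeProperty]
    (hK : IsResolving W₁ K) (Q : C₁ ⥤ H₁)
    [Q.IsLocalization W₁] {A B : H₁ ⥤ H₂} (τ : K.ι ⋙ Q ⋙ A ⟶ K.ι ⋙ Q ⋙ B) :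
    ∃ σ : A ⟶ B, ∀ P : K.FullSubcategory, σ.app (Q.obj P.obj) = τ.app P := by
  have hA : W₁.IsInvertedBy (Q ⋙ A) := fun X Y f hf => by
    have := Localization.inverts Q W₁ f hf
    dsimp
    infer_instance
  obtain ⟨σ, hσ⟩ := hK.exists_natTrans hA τ
  refine ⟨Localization.liftNatTrans Q W₁ (Q ⋙ A) (Q ⋙ B) A B σ, fun P => ?_⟩
  rw [Localization.liftNatTrans_app]
  simp [Localization.Lifting.iso, hσ P]

variable [W₁.HasTwoOutOfThreeProperty] (hK : IsResolving W₁ K)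
  (Q₁ : C₁ ⥤ H₁) [Q₁.IsLocalization W₁] (Q₂ : C₂ ⥤ H₂)
  (G : C₂ ⥤ C₁) (G' : H₂ ⥤ H₁) (e : G ⋙ Q₁ ≅ Q₂ ⋙ G')
  (i : C₀ ⥤ C₁) (T : C₀ ⥤ C₂) (η : i ⟶ T ⋙ G)
  (hη : ∀ (X : C₀) (Y : C₂) (h : i.obj X ⟶ G.obj Y), ∃! l : T.obj X ⟶ Y, η.app X ≫ G.map l = h)
  (k : K.FullSubcategory ⥤ C₀) (κ : k ⋙ i ≅ K.ι)

include hK hη in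
/-- The counit of the derived adjunction. -/
lemma exists_derived_counit (W₂ : MorphismProperty C₂) [Q₂.IsLocalization W₂]
    (L : H₁ ⥤ H₂) (φ : K.ι ⋙ Q₁ ⋙ L ≅ k ⋙ T ⋙ Q₂) :
    ∃ c : G' ⋙ L ⟶ 𝟭 H₂, ∀ (P : K.FullSubcategory) (Y : C₂) (a : P.obj ⟶ G.obj Y)
      (l : T.obj (k.obj P) ⟶ Y), η.app (k.obj P) ≫ G.map l = κ.hom.app P ≫ a →
      L.map (Q₁.map a) ≫ L.map (e.hom.app Y) ≫ c.app (Q₂.obj Y) = φ.hom.app P ≫ Q₂.map l := by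
  choose P q hP hq using hK.exists_resolution
  choose l hl hl' using hη
  let O (X : C₁) : K.FullSubcategory := ⟨P X, hP X⟩
  have lext {X : C₀} {Y : C₂} {f g : T.obj X ⟶ Y}
      (h : η.app X ≫ G.map f = η.app X ≫ G.map g) : f = g :=
    (hl' X Y _ f h).trans (hl' X Y _ g rfl).symm
  have := fun X => Localization.inverts Q₁ W₁ (q X) (hq X)
  -- On a resolution of `G Y` the functor `L` is computed by `T`, and there the counit has to be the
  -- transpose of the resolution map.
  let s (Y : C₂) : L.obj (Q₁.obj (G.obj Y)) ⟶ Q₂.obj Y :=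
    inv (L.map (Q₁.map (q (G.obj Y)))) ≫ φ.hom.app (O (G.obj Y)) ≫
      Q₂.map (l (k.obj (O (G.obj Y))) Y (κ.hom.app (O (G.obj Y)) ≫ q (G.obj Y)))
  have φnat {R R' : K.FullSubcategory} (f : R ⟶ R') :
      L.map (Q₁.map f.hom) ≫ φ.hom.app R' = φ.hom.app R ≫ Q₂.map (T.map (k.map f)) :=
    φ.hom.naturality f
  have κnat {R R' : K.FullSubcategory} (f : R ⟶ R') :
      i.map (k.map f) ≫ κ.hom.app R' = κ.hom.app R ≫ f.hom :=
    κ.hom.naturality f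
  have ηnat {X X' : C₀} (f : X ⟶ X') :
      η.app X ≫ G.map (T.map f) = i.map f ≫ η.app X' := (η.naturality f).symm
  have lpre {R R' : K.FullSubcategory} (f : R ⟶ R') {Y : C₂} (a : R'.obj ⟶ G.obj Y)
      (x : T.obj (k.obj R') ⟶ Y) (x' : T.obj (k.obj R) ⟶ Y)
      (hx : η.app (k.obj R') ≫ G.map x = κ.hom.app R' ≫ a)
      (hx' : η.app (k.obj R) ≫ G.map x' = κ.hom.app R ≫ f.hom ≫ a) :
      T.map (k.map f) ≫ x = x' := by
    apply lext
    rw [G.map_comp, ← Category.assoc, ηnat, Category.assoc, hx, hx', ← Category.assoc, κnat,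
      Category.assoc]
  have key (R : K.FullSubcategory) (Y : C₂) (a : R.obj ⟶ G.obj Y)
      (x : T.obj (k.obj R) ⟶ Y) (hx : η.app (k.obj R) ≫ G.map x = κ.hom.app R ≫ a) :
      L.map (Q₁.map a) ≫ s Y = φ.hom.app R ≫ Q₂.map x := by
    obtain ⟨Z, f, g, r, hZ, hr, rfl, hj⟩ :=
      hK.exists_cospan a (q (G.obj Y)) R.property (hP _) (hq _)
    let Z' : K.FullSubcategory := ⟨Z, hZ⟩
    let f' : R ⟶ Z' := K.homMk f
    let g' : O (G.obj Y) ⟶ Z' := K.homMk g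
    have hg : W₁ g := W₁.of_postcomp g r hr (by rw [hj]; exact hq _)
    have := Localization.inverts Q₁ W₁ g hg
    have hZl := hl (k.obj Z') Y (κ.hom.app Z' ≫ r)
    have h : L.map (Q₁.map r) ≫ s Y =
        φ.hom.app Z' ≫ Q₂.map (l (k.obj Z') Y (κ.hom.app Z' ≫ r)) := by
      rw [← cancel_epi (L.map (Q₁.map g)), ← L.map_comp_assoc, ← Q₁.map_comp, hj]
      simp only [s, IsIso.hom_inv_id_assoc]
      rw [← Category.assoc (L.map (Q₁.map g)), show L.map (Q₁.map g) ≫ φ.hom.app Z' = _ from φnat g',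
        Category.assoc, ← Q₂.map_comp]
      congr 2
      refine (lpre g' r _ _ hZl ?_).symm
      rw [hl, ← hj]
      rfl
    rw [Q₁.map_comp, L.map_comp, Category.assoc, h, ← Category.assoc,
      show L.map (Q₁.map f) ≫ φ.hom.app Z' = _ from φnat f', Category.assoc,
      ← Q₂.map_comp]
    congr 2
    exact lpre f' r _ _ hZl hx
  let c₀ : Q₂ ⋙ G' ⋙ L ⟶ Q₂ ⋙ 𝟭 H₂ :=
    { app := fun Y => L.map (e.inv.app Y) ≫ s Y
      naturality := fun Y Y' f => by
        have he : G'.map (Q₂.map f) ≫ e.inv.app Y' = e.inv.app Y ≫ Q₁.map (G.map f) :=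
          e.inv.naturality f
        dsimp
        rw [← L.map_comp_assoc, he, L.map_comp, Category.assoc, Category.assoc]
        congr 1
        rw [← cancel_epi (L.map (Q₁.map (q (G.obj Y)))), ← L.map_comp_assoc, ← Q₁.map_comp,
          ← Category.assoc _ _ (Q₂.map f),
          key (O (G.obj Y)) Y (q (G.obj Y)) _ (hl _ _ _), Category.assoc, ← Q₂.map_comp]
        apply key (O (G.obj Y))
        rw [G.map_comp, ← Category.assoc, hl, Category.assoc] }
  refine ⟨Localization.liftNatTrans Q₂ W₂ (Q₂ ⋙ G' ⋙ L) (Q₂ ⋙ 𝟭 H₂) (G' ⋙ L) (𝟭 H₂) c₀,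
    fun R Y a x hx => ?_⟩
  rw [← key R Y a x hx, Localization.liftNatTrans_app]
  congr 1
  simp only [Localization.Lifting.iso]
  simp [c₀, ← L.map_comp_assoc]

include hK hη κ in
/-- If the partially defined left adjoint `T` of `G` is defined on a resolving class and preserves
weak equivalences there, then its left derived functor exists and is left adjoint to the functor
induced by `G` on the localizations. -/
theorem exists_derived_adjunction [i.Full] (W₂ : MorphismProperty C₂) [Q₂.IsLocalization W₂]
    (hT : ∀ {P P' : K.FullSubcategory} (f : P ⟶ P'), W₁ f.hom →
      IsIso (Q₂.map (T.map (k.map f)))) :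
    ∃ (L : H₁ ⥤ H₂) (ε : (i ⋙ Q₁) ⋙ L ⟶ T ⋙ Q₂) (adj : L ⊣ G'), L.IsRightKanExtension ε ∧
      ∀ X : C₀, adj.unit.app (Q₁.obj (i.obj X)) ≫ G'.map (ε.app X) =
        Q₁.map (η.app X) ≫ e.hom.app (T.obj X) := by
  obtain ⟨R, hR, ⟨ρ⟩⟩ := hK.exists_functor (k ⋙ T ⋙ Q₂) hT
  let L : H₁ ⥤ H₂ := Localization.lift R hR Q₁
  let φ : K.ι ⋙ Q₁ ⋙ L ≅ k ⋙ T ⋙ Q₂ :=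
    Functor.isoWhiskerLeft K.ι (Localization.fac R hR Q₁) ≪≫ ρ
  -- From here on only the isomorphism `φ`, computing `L` on `K` by `T`, is used.
  clear_value φ L
  obtain ⟨c, hc⟩ := exists_derived_counit hK Q₁ Q₂ G G' e i T η hη k κ W₂ L φ
  have enat {Y Y' : C₂} (f : Y ⟶ Y') :
      Q₁.map (G.map f) ≫ e.hom.app Y' = e.hom.app Y ≫ G'.map (Q₂.map f) := e.hom.naturality f
  have ηnat {X X' : C₀} (f : X ⟶ X') :
      i.map f ≫ η.app X' = η.app X ≫ G.map (T.map f) := η.naturality f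
  have κnat {P P' : K.FullSubcategory} (f : P ⟶ P') :
      f.hom ≫ κ.inv.app P' = κ.inv.app P ≫ i.map (k.map f) :=
    κ.inv.naturality f
  have φnat {P P' : K.FullSubcategory} (f : P ⟶ P') :
      φ.inv.app P ≫ L.map (Q₁.map f.hom) = Q₂.map (T.map (k.map f)) ≫ φ.inv.app P' :=
    (φ.inv.naturality f).symm
  obtain ⟨unit, hunit⟩ := hK.exists_localization_natTrans Q₁ (A := 𝟭 H₁) (B := L ⋙ G')
    { app := fun P => Q₁.map (κ.inv.app P ≫ η.app (k.obj P)) ≫ e.hom.app (T.obj (k.obj P)) ≫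
        G'.map (φ.inv.app P)
      naturality := fun P P' f => by
        change Q₁.map f.hom ≫ Q₁.map (κ.inv.app P' ≫ η.app (k.obj P')) ≫
          e.hom.app (T.obj (k.obj P')) ≫ G'.map (φ.inv.app P') =
          (Q₁.map (κ.inv.app P ≫ η.app (k.obj P)) ≫ e.hom.app (T.obj (k.obj P)) ≫
            G'.map (φ.inv.app P)) ≫ G'.map (L.map (Q₁.map f.hom))
        rw [← Q₁.map_comp_assoc, ← Category.assoc f.hom, κnat, Category.assoc, ηnat]
        simp only [Q₁.map_comp, Category.assoc]
        rw [← Category.assoc (Q₁.map (G.map _)), enat]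
        simp only [Category.assoc, ← G'.map_comp]
        rw [← φnat] }
  have hunit' (P : K.FullSubcategory) : unit.app (Q₁.obj P.obj) =
      Q₁.map (κ.inv.app P ≫ η.app (k.obj P)) ≫ e.hom.app (T.obj (k.obj P)) ≫
        G'.map (φ.inv.app P) := hunit P
  have hc' (P : K.FullSubcategory) :
      L.map (Q₁.map (κ.inv.app P ≫ η.app (k.obj P))) ≫ L.map (e.hom.app (T.obj (k.obj P))) ≫
        c.app (Q₂.obj (T.obj (k.obj P))) = φ.hom.app P := by
    rw [hc P _ _ (𝟙 _)]
    · simp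
    · simp
  have tri₁ (Z : H₁) : L.map (unit.app Z) ≫ c.app (L.obj Z) = 𝟙 (L.obj Z) := by
    have : Functor.whiskerRight unit L ≫ Functor.whiskerLeft L c = 𝟙 L := by
      refine hK.localization_natTrans_ext Q₁ fun P hP => ?_
      let P' : K.FullSubcategory := ⟨P, hP⟩
      change L.map (unit.app (Q₁.obj P'.obj)) ≫ c.app (L.obj (Q₁.obj P'.obj)) = 𝟙 _
      have hcn : L.map (G'.map (φ.inv.app P')) ≫ c.app (L.obj (Q₁.obj P'.obj)) =
        c.app (Q₂.obj (T.obj (k.obj P'))) ≫ φ.inv.app P' := c.naturality (φ.inv.app P')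
      rw [hunit', L.map_comp, L.map_comp, Category.assoc, Category.assoc, hcn,
        ← Category.assoc (L.map (e.hom.app _)), ← Category.assoc, hc']
      exact φ.hom_inv_id_app P'
    exact NatTrans.congr_app this Z
  -- The identity is tested after the isomorphism induced by a resolution of `G Y`; there the
  -- transposed map `l` makes the unit and counit cancel.
  have tri₂ (Z : H₂) : unit.app (G'.obj Z) ≫ G'.map (c.app Z) = 𝟙 (G'.obj Z) := by
    have : Functor.whiskerLeft G' unit ≫ Functor.whiskerRight c G' = 𝟙 G' := by
      refine Localization.natTrans_ext Q₂ W₂ fun Y => ?_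
      change unit.app (G'.obj (Q₂.obj Y)) ≫ G'.map (c.app (Q₂.obj Y)) = 𝟙 _
      obtain ⟨P, q, hP, hq⟩ := hK.exists_resolution (G.obj Y)
      let P' : K.FullSubcategory := ⟨P, hP⟩
      obtain ⟨l, hl, -⟩ := hη (k.obj P') Y (κ.hom.app P' ≫ q)
      have := Localization.inverts Q₁ W₁ q hq
      have hun : (Q₁.map q ≫ e.hom.app Y) ≫ unit.app (G'.obj (Q₂.obj Y)) =
        unit.app (Q₁.obj P'.obj) ≫ G'.map (L.map (Q₁.map q ≫ e.hom.app Y)) :=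
          unit.naturality (Q₁.map q ≫ e.hom.app Y)
      rw [← cancel_epi (Q₁.map q ≫ e.hom.app Y), ← Category.assoc, hun, Category.assoc,
        ← G'.map_comp, L.map_comp, Category.assoc, hc P' Y q l hl, hunit', Category.assoc,
        Category.assoc, ← G'.map_comp, φ.inv_hom_id_app_assoc, ← enat, ← Q₁.map_comp_assoc,
        Category.assoc, hl, ← Category.assoc, κ.inv_hom_id_app]
      simp
    exact NatTrans.congr_app this Z
  let adj : L ⊣ G' :=
    { unit := unit, counit := c, left_triangle_components := tri₁,
      right_triangle_components := tri₂ }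
  -- The required compatibility with the unit says exactly that `ε` is the transpose of the image of
  -- `η` under the adjunction.
  let ε : (i ⋙ Q₁) ⋙ L ⟶ T ⋙ Q₂ :=
    { app := fun X => L.map (Q₁.map (η.app X) ≫ e.hom.app (T.obj X)) ≫ c.app _
      naturality := fun X X' f => by
        have hcn : L.map (G'.map (Q₂.map (T.map f))) ≫ c.app (Q₂.obj (T.obj X')) =
          c.app (Q₂.obj (T.obj X)) ≫ Q₂.map (T.map f) := c.naturality (Q₂.map (T.map f))
        dsimp
        rw [← L.map_comp_assoc, ← Q₁.map_comp_assoc, ηnat, Q₁.map_comp, Category.assoc, enat,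
          Category.assoc, ← hcn, ← L.map_comp_assoc, Category.assoc] }
  have hεk (P : K.FullSubcategory) :
      ε.app (k.obj P) = L.map (Q₁.map (κ.hom.app P)) ≫ φ.hom.app P := by
    rw [← hc', ← L.map_comp_assoc, ← Q₁.map_comp, κ.hom_inv_id_app_assoc, ← L.map_comp_assoc]
  -- Invertibility of `ε` on the resolving class is what gives the universal property: a competing
  -- map factors there in exactly one way, and the factorization extends.
  have hεiso (P : K.FullSubcategory) : IsIso (ε.app (k.obj P)) := by
    rw [hεk]
    infer_instance
  refine ⟨L, ε, adj, ⟨⟨?_⟩⟩, fun X => ?_⟩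
  · have hex (Λ : H₁ ⥤ H₂) (l : (i ⋙ Q₁) ⋙ Λ ⟶ T ⋙ Q₂) :
        ∃ δ : Λ ⟶ L, Functor.whiskerLeft (i ⋙ Q₁) δ ≫ ε = l := by
      have lnat {X X' : C₀} (f : X ⟶ X') : Λ.map (Q₁.map (i.map f)) ≫ l.app X' =
        l.app X ≫ Q₂.map (T.map f) := l.naturality f
      have εnat {X X' : C₀} (f : X ⟶ X') : L.map (Q₁.map (i.map f)) ≫ ε.app X' =
        ε.app X ≫ Q₂.map (T.map f) := ε.naturality f
      obtain ⟨δ, hδ⟩ := hK.exists_localization_natTrans Q₁ (A := Λ) (B := L)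
        { app := fun P => Λ.map (Q₁.map (κ.inv.app P)) ≫ l.app (k.obj P) ≫
            inv (ε.app (k.obj P)) ≫ L.map (Q₁.map (κ.hom.app P))
          naturality := fun P P' f => by
            have κnat' : i.map (k.map f) ≫ κ.hom.app P' = κ.hom.app P ≫ f.hom :=
              κ.hom.naturality f
            change Λ.map (Q₁.map f.hom) ≫ Λ.map (Q₁.map (κ.inv.app P')) ≫ l.app (k.obj P') ≫
              inv (ε.app (k.obj P')) ≫ L.map (Q₁.map (κ.hom.app P')) =
              (Λ.map (Q₁.map (κ.inv.app P)) ≫ l.app (k.obj P) ≫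
              inv (ε.app (k.obj P)) ≫ L.map (Q₁.map (κ.hom.app P))) ≫ L.map (Q₁.map f.hom)
            simp only [Category.assoc, ← L.map_comp, ← Q₁.map_comp]
            rw [← κnat', ← Λ.map_comp_assoc, ← Q₁.map_comp, κnat, Q₁.map_comp, Λ.map_comp,
              Category.assoc, ← Category.assoc (Λ.map (Q₁.map (i.map (k.map f)))), lnat,
              Category.assoc]
            congr 2
            rw [IsIso.eq_inv_comp, Q₁.map_comp, L.map_comp, ← Category.assoc, ← εnat,
              ← Category.assoc]
            simp }
      have hδ' (P : K.FullSubcategory) : δ.app (Q₁.obj (i.obj (k.obj P))) ≫ ε.app (k.obj P) =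
          l.app (k.obj P) := by
        have hP : δ.app (Q₁.obj P.obj) = Λ.map (Q₁.map (κ.inv.app P)) ≫ l.app (k.obj P) ≫
            inv (ε.app (k.obj P)) ≫ L.map (Q₁.map (κ.hom.app P)) := hδ P
        have hn : Λ.map (Q₁.map (κ.hom.app P)) ≫ δ.app (Q₁.obj P.obj) =
          δ.app (Q₁.obj (i.obj (k.obj P))) ≫ L.map (Q₁.map (κ.hom.app P)) :=
            δ.naturality (Q₁.map (κ.hom.app P))
        rw [hP, ← Λ.map_comp_assoc, ← Q₁.map_comp, κ.hom_inv_id_app] at hn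
        simp only [CategoryTheory.Functor.map_id, Category.id_comp, ← Category.assoc,
          Functor.comp_obj] at hn
        rw [cancel_mono] at hn
        simp [← hn]
      refine ⟨δ, ?_⟩
      ext X
      change δ.app (Q₁.obj (i.obj X)) ≫ ε.app X = l.app X
      -- Fullness of `i` lifts the resolution to a map `g` in the domain of `T`, along which the
      -- equation is transported from `k.obj P'` to `X`.
      obtain ⟨P, q, hP, hq⟩ := hK.exists_resolution (i.obj X)
      let P' : K.FullSubcategory := ⟨P, hP⟩
      obtain ⟨g, hg⟩ := i.map_surjective (κ.hom.app P' ≫ q)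
      have := Localization.inverts Q₁ W₁ q hq
      have : IsIso (Q₁.map (i.map g)) := by
        rw [hg, Q₁.map_comp]
        infer_instance
      rw [← cancel_epi (Λ.map (Q₁.map (i.map g))), ← Category.assoc, δ.naturality,
        Category.assoc, εnat, lnat, ← Category.assoc, hδ']
    have huniq {Λ : H₁ ⥤ H₂} (δ δ' : Λ ⟶ L) (h : Functor.whiskerLeft (i ⋙ Q₁) δ ≫ ε =
        Functor.whiskerLeft (i ⋙ Q₁) δ' ≫ ε) : δ = δ' := by
      refine hK.localization_natTrans_ext Q₁ fun P hP => ?_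
      let P' : K.FullSubcategory := ⟨P, hP⟩
      have h₁ := NatTrans.congr_app h (k.obj P')
      change δ.app (Q₁.obj (i.obj (k.obj P'))) ≫ ε.app (k.obj P') =
        δ'.app (Q₁.obj (i.obj (k.obj P'))) ≫ ε.app (k.obj P') at h₁
      rw [cancel_mono] at h₁
      have h₂ := δ.naturality (Q₁.map (κ.hom.app P'))
      have h₃ := δ'.naturality (Q₁.map (κ.hom.app P'))
      rw [← cancel_epi (Λ.map (Q₁.map (κ.hom.app P')))]
      exact h₂.trans ((congrArg (· ≫ L.map (Q₁.map (κ.hom.app P'))) h₁).trans h₃.symm)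
    exact IsTerminal.ofUniqueHom
      (fun E => CostructuredArrow.homMk (hex E.left E.hom).choose (hex E.left E.hom).choose_spec)
      (fun E f => by
        ext1
        exact huniq _ _ ((CostructuredArrow.w f).trans (hex E.left E.hom).choose_spec.symm))
  · change unit.app _ ≫ G'.map (L.map (Q₁.map (η.app X) ≫ e.hom.app (T.obj X)) ≫ c.app _) = _
    have hun := unit.naturality (Q₁.map (η.app X) ≫ e.hom.app (T.obj X))
    rw [G'.map_comp, ← Category.assoc]
    refine (congrArg (· ≫ G'.map (c.app _)) hun.symm).trans ?_
    dsimp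
    rw [Category.assoc, tri₂, Category.comp_id]

/-- The adjunction of a derived functor only depends on its universal property. -/
lemma exists_adjunction_of_isRightKanExtension {L L' : H₁ ⥤ H₂}
    {ε : (i ⋙ Q₁) ⋙ L ⟶ T ⋙ Q₂} {ε' : (i ⋙ Q₁) ⋙ L' ⟶ T ⋙ Q₂}
    [L.IsRightKanExtension ε] [L'.IsRightKanExtension ε'] (adj : L ⊣ G')
    (h : ∀ X : C₀, adj.unit.app (Q₁.obj (i.obj X)) ≫ G'.map (ε.app X) =
        Q₁.map (η.app X) ≫ e.hom.app (T.obj X)) :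
    ∃ adj' : L' ⊣ G', ∀ X : C₀, adj'.unit.app (Q₁.obj (i.obj X)) ≫ G'.map (ε'.app X) =
        Q₁.map (η.app X) ≫ e.hom.app (T.obj X) := by
  let θ := L.rightKanExtensionUnique ε L' ε'
  refine ⟨adj.ofNatIsoLeft θ, fun X => ?_⟩
  have hθ : θ.hom.app (Q₁.obj (i.obj X)) ≫ ε'.app X = ε.app X :=
    by simpa [θ] using L'.liftOfIsRightKanExtension_fac_app ε' L ε X
  rw [← h, ← hθ]
  simp

end DerivedAdjunction

/-! ### Coproducts, sequential colimits and pointwise computation -/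

section ElementaryColimits

variable {C : Type*} [Category* C]

/-- The maps `ι n : X n ⟶ Y` exhibit `Y` as the colimit of the sequence `f n : X n ⟶ X (n + 1)`. -/
structure IsSeqColim {X : ℕ → C} (f : ∀ n, X n ⟶ X (n + 1)) {Y : C} (ι : ∀ n, X n ⟶ Y) :
    Prop where
  comm : ∀ n, f n ≫ ι (n + 1) = ι n
  exists_desc : ∀ {Z : C} (g : ∀ n, X n ⟶ Z), (∀ n, f n ≫ g (n + 1) = g n) →
    ∃ d : Y ⟶ Z, ∀ n, ι n ≫ d = g n
  hom_ext : ∀ {Z : C} {a b : Y ⟶ Z}, (∀ n, ι n ≫ a = ι n ≫ b) → a = b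

/-- The maps `ι i : A i ⟶ P` exhibit `P` as the coproduct of the objects `A i`. -/
structure IsCoprod {I : Type*} {A : I → C} {P : C} (ι : ∀ i, A i ⟶ P) : Prop where
  exists_desc : ∀ {Z : C} (g : ∀ i, A i ⟶ Z), ∃ d : P ⟶ Z, ∀ i, ι i ≫ d = g i
  hom_ext : ∀ {Z : C} {a b : P ⟶ Z}, (∀ i, ι i ≫ a = ι i ≫ b) → a = b

lemma isCoprod_sigma {I : Type*} (A : I → C) [HasCoproduct A] :
    IsCoprod (fun i => Sigma.ι A i) where
  exists_desc g := ⟨Sigma.desc g, fun i => by simp⟩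
  hom_ext h := Sigma.hom_ext _ _ h

lemma IsCoprod.exists_iso {I : Type*} {A : I → C} {P P' : C} {ι : ∀ i, A i ⟶ P}
    {ι' : ∀ i, A i ⟶ P'} (h : IsCoprod ι) (h' : IsCoprod ι') :
    ∃ e : P ≅ P', ∀ i, ι i ≫ e.hom = ι' i := by
  obtain ⟨d, hd⟩ := h.exists_desc ι'
  obtain ⟨d', hd'⟩ := h'.exists_desc ι
  refine ⟨⟨d, d', h.hom_ext fun i => ?_, h'.hom_ext fun i => ?_⟩, hd⟩
  · rw [← Category.assoc, hd, hd', Category.comp_id]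
  · rw [← Category.assoc, hd', hd, Category.comp_id]

lemma IsSeqColim.exists_iso {X : ℕ → C} {f : ∀ n, X n ⟶ X (n + 1)} {Y Y' : C}
    {ι : ∀ n, X n ⟶ Y} {ι' : ∀ n, X n ⟶ Y'} (h : IsSeqColim f ι) (h' : IsSeqColim f ι') :
    ∃ e : Y ≅ Y', ∀ n, ι n ≫ e.hom = ι' n := by
  obtain ⟨d, hd⟩ := h.exists_desc ι' h'.comm
  obtain ⟨d', hd'⟩ := h'.exists_desc ι h.comm
  refine ⟨⟨d, d', h.hom_ext fun i => ?_, h'.hom_ext fun i => ?_⟩, hd⟩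
  · rw [← Category.assoc, hd, hd', Category.comp_id]
  · rw [← Category.assoc, hd', hd, Category.comp_id]

lemma IsSeqColim.of_iso {X : ℕ → C} {f : ∀ n, X n ⟶ X (n + 1)} {Y Y' : C}
    {ι : ∀ n, X n ⟶ Y} {ι' : ∀ n, X n ⟶ Y'} (h : IsSeqColim f ι) (e : Y ≅ Y')
    (he : ∀ n, ι n ≫ e.hom = ι' n) : IsSeqColim f ι' where
  comm n := by rw [← he, ← he, ← Category.assoc, h.comm]
  exists_desc g hg := by
    obtain ⟨d, hd⟩ := h.exists_desc g hg
    exact ⟨e.inv ≫ d, fun n => by rw [← he]; simp [hd]⟩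
  hom_ext {Z a b} hab := by
    rw [← cancel_epi e.hom]
    refine h.hom_ext fun n => ?_
    rw [← Category.assoc, ← Category.assoc, he, hab]

lemma isSeqColim_colimit {X : ℕ → C} (f : ∀ n, X n ⟶ X (n + 1))
    [HasColimit (Functor.ofSequence f)] :
    IsSeqColim f (fun n => colimit.ι (Functor.ofSequence f) n) where
  comm n := by
    have := colimit.w (Functor.ofSequence f) (homOfLE n.le_succ)
    rwa [Functor.ofSequence_map_homOfLE_succ] at this
  exists_desc {Z} g hg :=
    ⟨colimit.desc (Functor.ofSequence f) ⟨Z, NatTrans.ofSequence g (fun n => by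
      rw [Functor.ofSequence_map_homOfLE_succ]
      exact (hg n).trans (Category.comp_id _).symm)⟩,
      fun n => colimit.ι_desc _ n⟩
  hom_ext h := colimit.hom_ext h

variable {D : Type*} [Category* D]

/-- Sequential colimits of functors can be computed pointwise. -/
lemma exists_isSeqColim_functor {X : ℕ → D ⥤ C} (f : ∀ n, X n ⟶ X (n + 1))
    (hf : ∀ d, ∃ (Y : C) (ι : ∀ n, (X n).obj d ⟶ Y), IsSeqColim (fun n => (f n).app d) ι) :
    ∃ (Y : D ⥤ C) (ι : ∀ n, X n ⟶ Y), IsSeqColim f ι ∧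
      ∀ d, IsSeqColim (fun n => (f n).app d) (fun n => (ι n).app d) := by
  choose Y ι hι using hf
  have (d d' : D) (a : d ⟶ d') : ∃ m : Y d ⟶ Y d', ∀ n, ι d n ≫ m = (X n).map a ≫ ι d' n := by
    refine (hι d).exists_desc _ fun n => ?_
    rw [← (hι d').comm n, ← (f n).naturality_assoc]
  choose m hm using this
  let Y' : D ⥤ C :=
    { obj := Y
      map := fun a => m _ _ a
      map_id := fun d => (hι d).hom_ext fun n => by rw [hm]; simp
      map_comp := fun a b => (hι _).hom_ext fun n => by
        rw [hm, ← Category.assoc, hm, Category.assoc, hm]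
        simp }
  let ι' (n : ℕ) : X n ⟶ Y' := { app := fun d => ι d n, naturality := fun d d' a => (hm d d' a n).symm }
  refine ⟨Y', ι', ⟨fun n => ?_, fun {Z} g hg => ?_, fun {Z a b} hab => ?_⟩, hι⟩
  · ext d
    exact (hι d).comm n
  · have (d : D) := (hι d).exists_desc (fun n => (g n).app d) fun n => by rw [← hg n]; rfl
    choose t ht using this
    refine ⟨{ app := t, naturality := fun d d' a => (hι d).hom_ext fun n => ?_ }, fun n => ?_⟩
    · change ι d n ≫ m _ _ a ≫ _ = _
      rw [← Category.assoc, hm, Category.assoc, ht, ← Category.assoc, ht, (g n).naturality]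
    · ext d
      exact ht d n
  · ext d
    exact (hι d).hom_ext fun n => NatTrans.congr_app (hab n) d

/-- When the pointwise colimits exist they assemble to a colimit, and any other colimit of the
sequence is isomorphic to that one. -/
lemma IsSeqColim.app {X : ℕ → D ⥤ C} {f : ∀ n, X n ⟶ X (n + 1)} {Y : D ⥤ C} {ι : ∀ n, X n ⟶ Y}
    (h : IsSeqColim f ι)
    (hf : ∀ d, ∃ (Y : C) (ι : ∀ n, (X n).obj d ⟶ Y), IsSeqColim (fun n => (f n).app d) ι) (d : D) :
    IsSeqColim (fun n => (f n).app d) (fun n => (ι n).app d) := by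
  obtain ⟨Y', ι', h', h''⟩ := exists_isSeqColim_functor f hf
  obtain ⟨e, he⟩ := h'.exists_iso h
  exact (h'' d).of_iso (e.app d) fun n => by simp [← he]

lemma hasColimit_span_flip {X Y Z : D ⥤ C} (f : X ⟶ Y) (g : X ⟶ Z)
    (h : ∀ d, HasPushout (f.app d) (g.app d)) (d : D) : HasColimit ((span f g).flip.obj d) := by
  have := h d
  exact hasColimit_of_iso (F := span (f.app d) (g.app d)) (diagramIsoSpan ((span f g).flip.obj d))

lemma hasPushout_functor {X Y Z : D ⥤ C} (f : X ⟶ Y) (g : X ⟶ Z)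
    (h : ∀ d, HasPushout (f.app d) (g.app d)) : HasPushout f g := by
  have := hasColimit_span_flip f g h
  exact functorCategoryHasColimit (span f g)

lemma isPushout_app {X Y Z T : D ⥤ C} {f : X ⟶ Y} {g : X ⟶ Z} {k : Y ⟶ T} {j : Z ⟶ T}
    (hp : IsPushout f g k j) (h : ∀ d, HasPushout (f.app d) (g.app d)) (d : D) :
    IsPushout (f.app d) (g.app d) (k.app d) (j.app d) := by
  have := hasColimit_span_flip f g h
  exact hp.map ((evaluation D C).obj d)

end ElementaryColimits

/-! ### Cofibration axioms for arbitrary choices of colimits -/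

section Basic

variable {M : Type u} [Category.{v} M] {W Cof : MorphismProperty M}

namespace IsCofibrationCategory

variable (h : IsCofibrationCategory.{w} W Cof)

include h

lemma isCofibrant_of_isInitial {I : M} (hI : IsInitial I) : IsCofibrant Cof I := by
  obtain ⟨I₀, ⟨h₀⟩, hc⟩ := h.exists_initial
  exact ⟨I₀, h₀, h.cof_of_isIso _ (inferInstanceAs (IsIso (h₀.uniqueUpToIso hI).hom)) hc⟩

lemma isCofibrant_of_cof {A B : M} {f : A ⟶ B} (hA : IsCofibrant Cof A) (hf : Cof f) :
    IsCofibrant Cof B := by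
  obtain ⟨I, hI, hc⟩ := hA
  refine ⟨I, hI, ?_⟩
  rw [hI.hom_ext (hI.to B) (hI.to A ≫ f)]
  exact h.cof_comp _ _ hc hf

lemma isCofibrant_of_iso {A B : M} (e : A ≅ B) (hA : IsCofibrant Cof A) : IsCofibrant Cof B :=
  h.isCofibrant_of_cof hA (h.cof_of_isIso e.hom inferInstance hA)

lemma exists_isSeqColim {X : ℕ → M} (f : ∀ n, X n ⟶ X (n + 1)) (h₀ : IsCofibrant Cof (X 0))
    (hf : ∀ n, Cof (f n)) : ∃ (Y : M) (ι : ∀ n, X n ⟶ Y), IsSeqColim f ι ∧ Cof (ι 0) ∧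
      ((∀ n, W (f n)) → W (ι 0)) := by
  obtain ⟨_, h₁, h₂⟩ := h.sequence (Functor.ofSequence f) h₀
    fun n => by rw [Functor.ofSequence_map_homOfLE_succ]; exact hf n
  refine ⟨_, _, isSeqColim_colimit f, h₁, fun hw => h₂ fun n => ?_⟩
  rw [Functor.ofSequence_map_homOfLE_succ]
  exact hw n

lemma cof_seqColim {X : ℕ → M} {f : ∀ n, X n ⟶ X (n + 1)} (h₀ : IsCofibrant Cof (X 0))
    (hf : ∀ n, Cof (f n)) {Y : M} {ι : ∀ n, X n ⟶ Y} (hι : IsSeqColim f ι) :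
    Cof (ι 0) ∧ ((∀ n, W (f n)) → W (ι 0)) := by
  have := h.two_out_of_three
  obtain ⟨Y', ι', h', hc, hw⟩ := h.exists_isSeqColim f h₀ hf
  obtain ⟨e, he⟩ := h'.exists_iso hι
  rw [← he]
  exact ⟨h.cof_comp _ _ hc (h.cof_of_isIso _ inferInstance (h.isCofibrant_of_cof h₀ hc)),
    fun H => W.comp_mem _ _ (hw H) (h.weq_of_isIso _ inferInstance)⟩

lemma exists_isCoprod {I : Type w} (A : I → M) (hA : ∀ i, IsCofibrant Cof (A i)) :
    ∃ (P : M) (ι : ∀ i, A i ⟶ P), IsCoprod ι ∧ IsCofibrant Cof P := by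
  obtain ⟨_, _, h₁, -⟩ := h.coproduct A A (fun _ => 𝟙 _) hA
    fun i => h.cof_of_isIso _ inferInstance (hA i)
  exact ⟨_, _, isCoprod_sigma A, h₁⟩

lemma cof_coprod {I : Type w} {A B : I → M} {f : ∀ i, A i ⟶ B i}
    (hA : ∀ i, IsCofibrant Cof (A i)) (hf : ∀ i, Cof (f i)) {P P' : M} {ι : ∀ i, A i ⟶ P}
    {ι' : ∀ i, B i ⟶ P'} (hι : IsCoprod ι) (hι' : IsCoprod ι') (φ : P ⟶ P')
    (hφ : ∀ i, ι i ≫ φ = f i ≫ ι' i) : Cof φ ∧ ((∀ i, W (f i)) → W φ) := by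
  have := h.two_out_of_three
  obtain ⟨_, _, h₁, h₂, h₃, h₄⟩ := h.coproduct A B f hA hf
  obtain ⟨e, he⟩ := hι.exists_iso (isCoprod_sigma A)
  obtain ⟨e', he'⟩ := (isCoprod_sigma B).exists_iso hι'
  have : φ = e.hom ≫ Limits.Sigma.map f ≫ e'.hom := by
    refine hι.hom_ext fun i => ?_
    rw [hφ, ← Category.assoc, he]
    simp [he']
  rw [this]
  exact ⟨h.cof_comp _ _ (h.cof_of_isIso _ inferInstance (h.isCofibrant_of_iso e.symm h₁))
    (h.cof_comp _ _ h₃ (h.cof_of_isIso _ inferInstance h₂)),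
    fun H => W.comp_mem _ _ (h.weq_of_isIso _ inferInstance)
      (W.comp_mem _ _ (h₄ H) (h.weq_of_isIso _ inferInstance))⟩

end IsCofibrationCategory

end Basic

/-! ### Free diagrams and cellular maps -/

section Cells

variable {M : Type u} [Category.{v} M] {D : Type w} [SmallCategory D]

/-- The maps `ι s : A s ⟶ F.obj (d s)` exhibit `F` as the free diagram on the objects `A s`,
placed at `d s`. -/
def IsFree {S : Type w} (d : S → D) {A : S → M} {F : D ⥤ M} (ι : ∀ s, A s ⟶ F.obj (d s)) : Prop :=
  ∀ e : D, IsCoprod (A := fun x : (s : S) × (d s ⟶ e) => A x.1) (fun x => ι x.1 ≫ F.map x.2)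

namespace IsFree

variable {S : Type w} {d : S → D} {A : S → M} {F : D ⥤ M} {ι : ∀ s, A s ⟶ F.obj (d s)}

/-- The summand indexed by `x : d s ⟶ e` must map by `g s ≫ Y.map x`, so only the values at the
generators are free. -/
lemma exists_desc (hF : IsFree d ι) {Y : D ⥤ M} (g : ∀ s, A s ⟶ Y.obj (d s)) :
    ∃ φ : F ⟶ Y, ∀ s, ι s ≫ φ.app (d s) = g s := by
  have (e : D) := (hF e).exists_desc (fun x => g x.1 ≫ Y.map x.2)
  choose φ hφ using this
  refine ⟨{ app := φ, naturality := fun e e' a => (hF e).hom_ext fun x => ?_ }, fun s => ?_⟩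
  · have := hφ e' ⟨x.1, x.2 ≫ a⟩
    rw [← Category.assoc (ι x.1 ≫ F.map x.2) (φ e), hφ e x]
    simpa using this
  · simpa using hφ (d s) ⟨s, 𝟙 _⟩

lemma hom_ext (hF : IsFree d ι) {Y : D ⥤ M} {φ ψ : F ⟶ Y}
    (h : ∀ s, ι s ≫ φ.app (d s) = ι s ≫ ψ.app (d s)) : φ = ψ := by
  ext e
  refine (hF e).hom_ext fun x => ?_
  rw [Category.assoc, Category.assoc, φ.naturality, ψ.naturality, ← Category.assoc, h,
    Category.assoc]

end IsFree

/-- Pointwise cofibrant diagrams. -/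
def PCof (Cof : MorphismProperty M) (X : D ⥤ M) : Prop := ∀ d, IsCofibrant Cof (X.obj d)

/-- Cellular maps of diagrams: the closure of the free maps on families of maps in `J` with
cofibrant domains under pushouts, compositions and sequential compositions. -/
inductive Cell (Cof J : MorphismProperty M) : ∀ {X Y : D ⥤ M}, (X ⟶ Y) → Prop
  | free {S : Type w} {d : S → D} {A B : S → M} {a : ∀ s, A s ⟶ B s} {F F' : D ⥤ M}
      {ι : ∀ s, A s ⟶ F.obj (d s)} {ι' : ∀ s, B s ⟶ F'.obj (d s)} {φ : F ⟶ F'}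
      (hA : ∀ s, IsCofibrant Cof (A s)) (ha : ∀ s, J (a s)) (hF : IsFree d ι) (hF' : IsFree d ι')
      (hφ : ∀ s, ι s ≫ φ.app (d s) = a s ≫ ι' s) : Cell Cof J φ
  | pushout {X X' Z Z' : D ⥤ M} {f : X ⟶ X'} {g : X ⟶ Z} {g' : X' ⟶ Z'} {f' : Z ⟶ Z'}
      (hf : Cell Cof J f) (hX : PCof Cof X) (hZ : PCof Cof Z) (hp : IsPushout f g g' f') :
      Cell Cof J f'
  | comp {X Y Z : D ⥤ M} {f : X ⟶ Y} {g : Y ⟶ Z} (hf : Cell Cof J f) (hg : Cell Cof J g) :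
      Cell Cof J (f ≫ g)
  | seq {X : ℕ → D ⥤ M} {f : ∀ n, X n ⟶ X (n + 1)} {Y : D ⥤ M} {ι : ∀ n, X n ⟶ Y}
      (hf : ∀ n, Cell Cof J (f n)) (hι : IsSeqColim f ι) : Cell Cof J (ι 0)

variable {W Cof J : MorphismProperty M}

lemma Cell.mono {J' : MorphismProperty M} (hJ : J ≤ J') {X Y : D ⥤ M} {f : X ⟶ Y}
    (hf : Cell Cof J f) : Cell Cof J' f := by
  induction hf with
  | free hA ha hF hF' hφ => exact .free hA (fun s => hJ _ (ha s)) hF hF' hφ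
  | pushout _ hX hZ hp ih => exact .pushout ih hX hZ hp
  | comp _ _ ih₁ ih₂ => exact .comp ih₁ ih₂
  | seq _ hι ih => exact .seq ih hι

namespace IsCofibrationCategory

variable (h : IsCofibrationCategory.{w} W Cof)

include h

/-- The value at `e` is the coproduct of the `A s` over all pairs of `s` and a map `d s ⟶ e`. This
index set is small since `D` is, so CF5 applies; maps of `D` act by composition on the indices. -/
lemma exists_isFree {S : Type w} (d : S → D) (A : S → M) (hA : ∀ s, IsCofibrant Cof (A s)) :
    ∃ (F : D ⥤ M) (ι : ∀ s, A s ⟶ F.obj (d s)), IsFree d ι ∧ PCof Cof F := by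
  choose P ι hι hP using
    fun e : D => h.exists_isCoprod (fun x : (s : S) × (d s ⟶ e) => A x.1) fun x => hA x.1
  have (e e' : D) (a : e ⟶ e') := (hι e).exists_desc fun x => ι e' ⟨x.1, x.2 ≫ a⟩
  choose m hm using this
  have hcongr {e : D} {s : S} {x y : d s ⟶ e} (hxy : x = y) : ι e ⟨s, x⟩ = ι e ⟨s, y⟩ := by rw [hxy]
  let F : D ⥤ M :=
    { obj := P
      map := fun a => m _ _ a
      map_id := fun e => (hι e).hom_ext fun x => by
        rw [hm]
        exact (hcongr (Category.comp_id _)).trans (Category.comp_id _).symm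
      map_comp := fun a b => (hι _).hom_ext fun x => by
        rw [← Category.assoc, hm, hm, hm]
        exact hcongr (Category.assoc _ _ _).symm }
  refine ⟨F, fun s => ι (d s) ⟨s, 𝟙 _⟩, fun e => ?_, hP⟩
  have : (fun x : (s : S) × (d s ⟶ e) => ι (d x.1) ⟨x.1, 𝟙 _⟩ ≫ F.map x.2) = ι e := by
    funext x
    exact (hm _ _ _ _).trans (hcongr (Category.id_comp _))
  rw [this]
  exact hι e

lemma hasPushout_app {X Y Z : D ⥤ M} {f : X ⟶ Y} {g : X ⟶ Z} (hX : PCof Cof X) (hZ : PCof Cof Z)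
    (hf : ∀ e, Cof (f.app e)) (e : D) : HasPushout (f.app e) (g.app e) :=
  h.hasPushout _ _ (hf e) (hX e) (hZ e)

lemma pcof_of_cof {X Y : D ⥤ M} {f : X ⟶ Y} (hX : PCof Cof X) (hf : ∀ e, Cof (f.app e)) :
    PCof Cof Y := fun e => h.isCofibrant_of_cof (hX e) (hf e)

lemma exists_isSeqColim_functor {X : ℕ → D ⥤ M} (f : ∀ n, X n ⟶ X (n + 1))
    (h₀ : PCof Cof (X 0)) (hf : ∀ n e, Cof ((f n).app e)) :
    ∃ (Y : D ⥤ M) (ι : ∀ n, X n ⟶ Y), IsSeqColim f ι := by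
  obtain ⟨Y, ι, hι, -⟩ := ABC.exists_isSeqColim_functor f fun e => by
    obtain ⟨Y, ι, hι, -⟩ := h.exists_isSeqColim (fun n => (f n).app e) (h₀ e) fun n => hf n e
    exact ⟨Y, ι, hι⟩
  exact ⟨Y, ι, hι⟩

lemma isSeqColim_app {X : ℕ → D ⥤ M} {f : ∀ n, X n ⟶ X (n + 1)}
    (h₀ : PCof Cof (X 0)) (hf : ∀ n e, Cof ((f n).app e)) {Y : D ⥤ M} {ι : ∀ n, X n ⟶ Y}
    (hι : IsSeqColim f ι) (e : D) : IsSeqColim (fun n => (f n).app e) (fun n => (ι n).app e) := by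
  refine hι.app (fun e => ?_) e
  obtain ⟨Y, ι, hι, -⟩ := h.exists_isSeqColim (fun n => (f n).app e) (h₀ e) fun n => hf n e
  exact ⟨Y, ι, hι⟩

/-- Cellular maps are pointwise cofibrations, and pointwise weak equivalences if they are built
from weak equivalences. -/
lemma cell_app (hJ : J ≤ Cof) {X Y : D ⥤ M} {f : X ⟶ Y} (hf : Cell Cof J f) (hX : PCof Cof X) :
    ∀ e, Cof (f.app e) ∧ (J ≤ W → W (f.app e)) := by
  have := h.two_out_of_three
  induction hf with
  | @free S d A B a F F' ι ι' φ hA ha hF hF' hφ =>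
    intro e
    have := h.cof_coprod (fun x : (s : S) × (d s ⟶ e) => hA x.1) (fun x => hJ _ (ha x.1)) (hF e)
      (hF' e) (φ.app e) fun x => by
        rw [Category.assoc, φ.naturality, ← Category.assoc, hφ, Category.assoc]
    exact ⟨this.1, fun hW => this.2 fun x => hW _ (ha x.1)⟩
  | pushout hf hX' hZ hp ih =>
    intro e
    have hp' := isPushout_app hp (h.hasPushout_app hX' hZ fun e => (ih hX' e).1) e
    exact ⟨h.cof_pushout _ _ _ _ (ih hX' e).1 (hX' e) (hZ e) hp', fun hW =>
      h.weq_pushout _ _ _ _ (ih hX' e).1 ((ih hX' e).2 hW) (hX' e) (hZ e) hp'⟩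
  | comp hf hg ih₁ ih₂ =>
    intro e
    have h₁ := ih₁ hX
    have h₂ := ih₂ (h.pcof_of_cof hX fun e => (h₁ e).1)
    exact ⟨h.cof_comp _ _ (h₁ e).1 (h₂ e).1, fun hW => W.comp_mem _ _ ((h₁ e).2 hW) ((h₂ e).2 hW)⟩
  | @seq X f Y ι hf hι ih =>
    have hXn (n : ℕ) : PCof Cof (X n) := by
      induction n with
      | zero => exact hX
      | succ n hn => exact h.pcof_of_cof hn fun e => (ih n hn e).1
    intro e
    have := h.cof_seqColim (hX e) (fun n => (ih n (hXn n) e).1)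
      (h.isSeqColim_app hX (fun n e => (ih n (hXn n) e).1) hι e)
    exact ⟨this.1, fun hW => this.2 fun n => (ih n (hXn n) e).2 hW⟩

lemma pcof_of_cell (hJ : J ≤ Cof) {X Y : D ⥤ M} {f : X ⟶ Y} (hf : Cell Cof J f)
    (hX : PCof Cof X) : PCof Cof Y :=
  h.pcof_of_cof hX fun e => (h.cell_app hJ hf hX e).1

/-- Cells can be attached to pointwise cofibrant diagrams, and the result is characterized by
its universal property, globally and pointwise. -/
lemma exists_attach (hJ : J ≤ Cof) {Z : D ⥤ M} (hZ : PCof Cof Z) {S : Type w} (d : S → D)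
    {A B : S → M} (a : ∀ s, A s ⟶ B s) (hA : ∀ s, IsCofibrant Cof (A s)) (ha : ∀ s, J (a s))
    (α : ∀ s, A s ⟶ Z.obj (d s)) :
    ∃ (Z' : D ⥤ M) (t : Z ⟶ Z') (β : ∀ s, B s ⟶ Z'.obj (d s)), Cell Cof J t ∧
      (∀ s, α s ≫ t.app (d s) = a s ≫ β s) ∧
      (∀ (Y : D ⥤ M) (k : Z ⟶ Y) (b : ∀ s, B s ⟶ Y.obj (d s)),
        (∀ s, α s ≫ k.app (d s) = a s ≫ b s) →
        ∃ l : Z' ⟶ Y, t ≫ l = k ∧ ∀ s, β s ≫ l.app (d s) = b s) ∧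
      (∀ (Y : D ⥤ M) (l l' : Z' ⟶ Y), t ≫ l = t ≫ l' →
        (∀ s, β s ≫ l.app (d s) = β s ≫ l'.app (d s)) → l = l') ∧
      ∀ e : D, (∀ (N : M) (k : Z.obj e ⟶ N) (b : ∀ s, (d s ⟶ e) → (B s ⟶ N)),
        (∀ s x, α s ≫ Z.map x ≫ k = a s ≫ b s x) →
        ∃ l : Z'.obj e ⟶ N, t.app e ≫ l = k ∧ ∀ s x, β s ≫ Z'.map x ≫ l = b s x) ∧
        (∀ (N : M) (l l' : Z'.obj e ⟶ N), t.app e ≫ l = t.app e ≫ l' →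
          (∀ s x, β s ≫ Z'.map x ≫ l = β s ≫ Z'.map x ≫ l') → l = l') := by
  obtain ⟨F, ι, hF, hFc⟩ := h.exists_isFree d A hA
  obtain ⟨F', ι', hF', -⟩ := h.exists_isFree d B
    fun s => h.isCofibrant_of_cof (hA s) (hJ _ (ha s))
  obtain ⟨φ, hφ⟩ := hF.exists_desc fun s => a s ≫ ι' s
  obtain ⟨g, hg⟩ := hF.exists_desc α
  have hcell : Cell Cof J φ := .free hA ha hF hF' hφ
  have hφc e := (h.cell_app hJ hcell hFc e).1
  have := hasPushout_functor φ g (h.hasPushout_app hFc hZ hφc)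
  have hp := IsPushout.of_hasPushout φ g
  have hpe := isPushout_app hp (h.hasPushout_app hFc hZ hφc)
  refine ⟨_, _, fun s => ι' s ≫ (pushout.inl φ g).app (d s), .pushout hcell hFc hZ hp,
    fun s => ?_, fun Y k b hb => ?_, fun Y l l' hl hl' => ?_,
    fun e => ⟨fun N k b hb => ?_, fun N l l' hl hl' => ?_⟩⟩
  · rw [← hg, Category.assoc, ← NatTrans.comp_app, ← hp.w, ← Category.assoc (a s), ← hφ]
    simp
  · obtain ⟨b', hb'⟩ := hF'.exists_desc b
    have hw : φ ≫ b' = g ≫ k := hF.hom_ext fun s => by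
      rw [NatTrans.comp_app, NatTrans.comp_app, ← Category.assoc, hφ, Category.assoc, hb',
        ← Category.assoc, hg, hb]
    refine ⟨hp.desc b' k hw, hp.inr_desc _ _ _, fun s => ?_⟩
    rw [Category.assoc, ← NatTrans.comp_app, hp.inl_desc, hb']
  · refine hp.hom_ext (hF'.hom_ext fun s => ?_) hl
    simpa using hl' s
  · obtain ⟨b', hb'⟩ := (hF' e).exists_desc fun x => b x.1 x.2
    have hw : φ.app e ≫ b' = g.app e ≫ k := (hF e).hom_ext fun x => by
      rw [Category.assoc, ← Category.assoc (F.map x.2), φ.naturality, ← Category.assoc,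
        ← Category.assoc, hφ, Category.assoc, Category.assoc (a x.1), ← Category.assoc (ι' x.1),
        hb', ← hb, Category.assoc,
        ← Category.assoc (F.map x.2), g.naturality, Category.assoc, ← Category.assoc (ι x.1), hg]
    refine ⟨(hpe e).desc b' k hw, (hpe e).inr_desc _ _ _, fun s x => ?_⟩
    rw [Category.assoc, ← Category.assoc ((pushout.inl φ g).app (d s)),
      ← (pushout.inl φ g).naturality, Category.assoc, (hpe e).inl_desc]
    simpa using hb' ⟨s, x⟩
  · refine (hpe e).hom_ext ((hF' e).hom_ext fun x => ?_) hl
    have := hl' x.1 x.2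
    rw [Category.assoc, ← Category.assoc ((pushout.inl φ g).app (d x.1)),
      ← (pushout.inl φ g).naturality, Category.assoc, Category.assoc,
      ← Category.assoc ((pushout.inl φ g).app (d x.1)),
      ← (pushout.inl φ g).naturality, Category.assoc] at this
    simpa using this

end IsCofibrationCategory

end Cells

/-- Two interleaved sequences have the same colimit. -/
lemma IsSeqColim.interleave {C : Type*} [Category* C] {X B : ℕ → C} {x : ∀ n, X n ⟶ B n}
    {y : ∀ n, B n ⟶ X (n + 1)} {Y : C} {ι : ∀ n, X n ⟶ Y}
    (h : IsSeqColim (fun n => x n ≫ y n) ι) :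
    IsSeqColim (fun n => y n ≫ x (n + 1)) (fun n => y n ≫ ι (n + 1)) where
  comm n := by
    have := h.comm (n + 1)
    simp only [Category.assoc] at this ⊢
    rw [this]
  exists_desc g hg := by
    simp only [Category.assoc] at hg
    obtain ⟨d, hd⟩ := h.exists_desc (fun n => x n ≫ g n) fun n => by
      simp only [Category.assoc, hg]
    exact ⟨d, fun n => by rw [Category.assoc, hd, hg]⟩
  hom_ext {Z a b} hab := by
    refine h.hom_ext fun n => ?_
    have := hab n
    simp only [Category.assoc] at this
    rw [← h.comm n]
    simp only [Category.assoc, this]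

/-! ### Factorization, lifting and Kan extension for cellular maps -/

section Cells

variable {M : Type u} [Category.{v} M] {D : Type w} [SmallCategory D]
  {W Cof J : MorphismProperty M}

namespace IsCofibrationCategory

variable (h : IsCofibrationCategory.{w} W Cof)

include h

/-- Attaching a cell at every object `e`, along all of `X.obj e`, yields an object that at `e` is
obtained from the cell at `e` by a cofibration. -/
lemma exists_attach_all {X : D ⥤ M} (hX : PCof Cof X) {B : D → M} (x : ∀ e, X.obj e ⟶ B e)
    (hx : ∀ e, Cof (x e)) :
    ∃ (X' : D ⥤ M) (t : X ⟶ X') (y : ∀ e, B e ⟶ X'.obj e), Cell Cof Cof t ∧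
      (∀ e, x e ≫ y e = t.app e) ∧ (∀ e, Cof (y e)) ∧
      ∀ (Y : D ⥤ M) (f : X ⟶ Y) (b : ∀ e, B e ⟶ Y.obj e), (∀ e, x e ≫ b e = f.app e) →
        ∃ f' : X' ⟶ Y, t ≫ f' = f ∧ ∀ e, y e ≫ f'.app e = b e := by
  obtain ⟨X', t, y, ht, hy, hdesc, -, hpt⟩ := h.exists_attach le_rfl hX (d := fun e : D => e) x hX hx
    (fun e => 𝟙 _)
  simp only [Category.id_comp] at hy
  have hB e : IsCofibrant Cof (B e) := h.isCofibrant_of_cof (hX e) (hx e)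
  refine ⟨X', t, y, ht, fun e => (hy e).symm, fun e => ?_, fun Y f b hb => ?_⟩
  · obtain ⟨hd, he⟩ := hpt e
    -- Among the cells that reach `e`, the one indexed by the identity turns `X.obj e` into `B e`.
    -- The remaining ones are then attached to `B e`, so `y e` is a pushout of a coproduct of
    -- cofibrations over the other indices.
    let I := {z : (s : D) × (s ⟶ e) // z ≠ ⟨e, 𝟙 e⟩}
    obtain ⟨P, ι, hι, hP⟩ := h.exists_isCoprod (fun z : I => X.obj z.1.1) fun z => hX _
    obtain ⟨P', ι', hι', -⟩ := h.exists_isCoprod (fun z : I => B z.1.1) fun z => hB _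
    obtain ⟨φ, hφ⟩ := hι.exists_desc fun z => x z.1.1 ≫ ι' z
    obtain ⟨g, hg⟩ := hι.exists_desc fun z => X.map z.1.2 ≫ x e
    obtain ⟨g', hg'⟩ := hι'.exists_desc fun z => y z.1.1 ≫ X'.map z.1.2
    have hw : φ ≫ g' = g ≫ y e := hι.hom_ext fun z => by
      rw [← Category.assoc, hφ, Category.assoc, hg', ← Category.assoc, ← hy, ← Category.assoc, hg,
        Category.assoc, ← hy, t.naturality]
    refine h.cof_pushout φ g g' (y e)
      (h.cof_coprod (fun z : I => hX z.1.1) (fun z => hx _) hι hι' φ hφ).1 hP (hB e) ⟨⟨hw⟩, ⟨?_⟩⟩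
    have ex (s : PushoutCocone φ g) : ∃ l : X'.obj e ⟶ s.pt, g' ≫ l = s.inl ∧ y e ≫ l = s.inr := by
      classical
      let b (z : (s : D) × (s ⟶ e)) : B z.1 ⟶ s.pt :=
        if hz : z = ⟨e, 𝟙 e⟩ then hz ▸ s.inr else ι' ⟨z, hz⟩ ≫ s.inl
      have hb₀ : b ⟨e, 𝟙 e⟩ = s.inr := dif_pos rfl
      have hb₁ (z : I) : b z.1 = ι' z ≫ s.inl := dif_neg z.2
      have hb (z : (s : D) × (s ⟶ e)) : X.map z.2 ≫ x e ≫ s.inr = x z.1 ≫ b z := by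
        by_cases hz : z = ⟨e, 𝟙 e⟩
        · subst hz
          simp [hb₀]
        · rw [hb₁ ⟨z, hz⟩, ← Category.assoc, ← Category.assoc, ← hg ⟨z, hz⟩, ← hφ ⟨z, hz⟩,
            Category.assoc, Category.assoc, s.condition]
      obtain ⟨l, hl, hl'⟩ := hd s.pt (x e ≫ s.inr) (fun d m => b ⟨d, m⟩) fun d m => by
        simpa using hb ⟨d, m⟩
      refine ⟨l, hι'.hom_ext fun z => ?_, ?_⟩
      · rw [← Category.assoc, hg', Category.assoc, hl', hb₁]
      · simpa [hb₀] using hl' e (𝟙 e)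
    choose l hl hl' using ex
    refine PushoutCocone.IsColimit.mk _ l hl hl' fun s m hm hm' => he _ _ _ ?_ fun d n => ?_
    · rw [hy, Category.assoc, Category.assoc, hm', hl']
    · by_cases hz : (⟨d, n⟩ : (s : D) × (s ⟶ e)) = ⟨e, 𝟙 e⟩
      · cases hz
        simp [hm', hl']
      · have := hg' ⟨⟨d, n⟩, hz⟩
        dsimp at this
        rw [← Category.assoc, ← Category.assoc, ← this, Category.assoc, Category.assoc, hm, hl]
  · obtain ⟨l, hl, hl'⟩ := hdesc Y f b fun e => by simp [hb]
    exact ⟨l, hl, hl'⟩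

/-- Every map from a pointwise cofibrant diagram factors as a cellular map followed by a pointwise
weak equivalence. -/
lemma exists_cell_factorization {X Y : D ⥤ M} (hX : PCof Cof X) (f : X ⟶ Y) :
    ∃ (Z : D ⥤ M) (i : X ⟶ Z) (r : Z ⟶ Y), Cell Cof Cof i ∧ (∀ e, W (r.app e)) ∧ i ≫ r = f := by
  have := h.two_out_of_three
  have step (X : D ⥤ M) (hX : PCof Cof X) (f : X ⟶ Y) : ∃ (X' : D ⥤ M) (t : X ⟶ X') (f' : X' ⟶ Y)
      (B : D → M) (x : ∀ e, X.obj e ⟶ B e) (y : ∀ e, B e ⟶ X'.obj e) (b : ∀ e, B e ⟶ Y.obj e),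
      Cell Cof Cof t ∧ t ≫ f' = f ∧ (∀ e, Cof (x e)) ∧ (∀ e, Cof (y e)) ∧ (∀ e, W (b e)) ∧
      (∀ e, x e ≫ y e = t.app e) ∧ (∀ e, y e ≫ f'.app e = b e) := by
    -- The pointwise factorizations need not form a diagram, so they are attached as free cells at
    -- all objects at once. The resulting map to `Y` need not be a weak equivalence, which is why
    -- the step is iterated.
    choose B x b hx hb hxb using fun e => h.factorization (f.app e) (hX e)
    obtain ⟨X', t, y, ht, hxy, hy, hdesc⟩ := h.exists_attach_all hX x hx
    obtain ⟨f', hf', hyf'⟩ := hdesc Y f b hxb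
    exact ⟨X', t, f', B, x, y, b, ht, hf', hx, hy, hb, hxy, hyf'⟩
  choose X' t f' B x y b ht hf' hx hy hb hxy hyf' using step
  let st (n : ℕ) : {p : (X : D ⥤ M) × (X ⟶ Y) // PCof Cof p.1} :=
    Nat.rec ⟨⟨X, f⟩, hX⟩ (fun _ p => ⟨⟨X' p.1.1 p.2 p.1.2, f' p.1.1 p.2 p.1.2⟩,
      h.pcof_of_cell le_rfl (ht p.1.1 p.2 p.1.2) p.2⟩) n
  let T (n : ℕ) : (st n).1.1 ⟶ (st (n + 1)).1.1 := t _ (st n).2 (st n).1.2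
  have hT (n : ℕ) : Cell Cof Cof (T n) := ht _ _ _
  have hTc (n : ℕ) (e : D) : Cof ((T n).app e) := (h.cell_app le_rfl (hT n) (st n).2 e).1
  have hTf (n : ℕ) : T n ≫ (st (n + 1)).1.2 = (st n).1.2 := hf' _ _ _
  obtain ⟨Z, ι, hι⟩ := h.exists_isSeqColim_functor T hX hTc
  obtain ⟨r, hr⟩ := hι.exists_desc (fun n => (st n).1.2) hTf
  refine ⟨Z, ι 0, r, .seq hT hι, fun e => ?_, hr 0⟩
  let Bn (n : ℕ) : M := B _ (st n).2 (st n).1.2 e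
  let xn (n : ℕ) : (st n).1.1.obj e ⟶ Bn n := x _ _ _ e
  let yn (n : ℕ) : Bn n ⟶ (st (n + 1)).1.1.obj e := y _ _ _ e
  let bn (n : ℕ) : Bn n ⟶ Y.obj e := b _ _ _ e
  have hxn (n : ℕ) : Cof (xn n) := hx _ _ _ _
  have hyn (n : ℕ) : Cof (yn n) := hy _ _ _ _
  have hbn (n : ℕ) : W (bn n) := hb _ _ _ _
  have hxyn (n : ℕ) : xn n ≫ yn n = (T n).app e := hxy _ _ _ _
  have hyb (n : ℕ) : yn n ≫ (st (n + 1)).1.2.app e = bn n := hyf' _ _ _ _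
  have hxb (n : ℕ) : xn n ≫ bn n = (st n).1.2.app e := by
    rw [← hyb, ← Category.assoc, hxyn, ← hTf n, NatTrans.comp_app]
  have hybn (n : ℕ) : (yn n ≫ xn (n + 1)) ≫ bn (n + 1) = bn n :=
    (Category.assoc _ _ _).trans ((congrArg (yn n ≫ ·) (hxb (n + 1))).trans (hyb n))
  have hι' : IsSeqColim (fun n => xn n ≫ yn n) (fun n => (ι n).app e) := by
    simp only [hxyn]
    exact h.isSeqColim_app hX hTc hι e
  -- At `e` the sequence interleaves with the objects `Bn n`, all weakly equivalent to `Y.obj e`.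
  -- Hence the maps `Bn n ⟶ Bn (n + 1)` are trivial cofibrations, and so is the map from `Bn 0` to
  -- the common colimit.
  have hW := (h.cof_seqColim (h.isCofibrant_of_cof (hX e) (hxn 0))
    (fun n => h.cof_comp _ _ (hyn n) (hxn (n + 1))) hι'.interleave).2 fun n =>
      W.of_postcomp _ (bn (n + 1)) (hbn (n + 1)) (by rw [hybn]; exact hbn n)
  refine W.of_precomp _ _ hW ?_
  rw [Category.assoc, ← NatTrans.comp_app, hr, hyb]
  exact hbn 0

/-- Cellular maps have the left lifting property with respect to pointwise weak equivalences, up to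
enlarging the source of the latter by a trivial cellular map. -/
lemma exists_lift {P P' : D ⥤ M} {f : P ⟶ P'} (hf : Cell Cof Cof f) {Z Y : D ⥤ M}
    (hZ : PCof Cof Z) (p : P ⟶ Z) (y : P' ⟶ Y) (r : Z ⟶ Y) (hr : ∀ e, W (r.app e))
    (hw : f ≫ y = p ≫ r) :
    ∃ (Z' : D ⥤ M) (t : Z ⟶ Z') (r' : Z' ⟶ Y) (s : P' ⟶ Z'), Cell Cof (Cof ⊓ W) t ∧
      (∀ e, W (r'.app e)) ∧ t ≫ r' = r ∧ s ≫ r' = y ∧ f ≫ s = p ≫ t := by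
  have := h.two_out_of_three
  have weq {Z Z' : D ⥤ M} {t : Z ⟶ Z'} {r : Z ⟶ Y} {r' : Z' ⟶ Y} (hZ : PCof Cof Z)
      (ht : Cell Cof (Cof ⊓ W) t) (hr : ∀ e, W (r.app e)) (htr : t ≫ r' = r) (e : D) :
      W (r'.app e) :=
    W.of_precomp (t.app e) _ ((h.cell_app inf_le_left ht hZ e).2 inf_le_right)
      (by rw [← NatTrans.comp_app, htr]; exact hr e)
  induction hf generalizing Z Y with
  | @free S d A B a F F' ι ι' φ hA ha hF hF' hφ =>
    -- Push the cell out along its attaching map into `Z` and factor the induced map to `Y`. The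
    -- resulting cofibration out of `Z.obj (d s)` is trivial by two out of three, and its target
    -- receives `B s`.
    have key (s : S) : ∃ (N : M) (a' : Z.obj (d s) ⟶ N) (b' : B s ⟶ N) (n : N ⟶ Y.obj (d s)),
        (Cof ⊓ W) a' ∧ (ι s ≫ p.app (d s)) ≫ a' = a s ≫ b' ∧ a' ≫ n = r.app (d s) ∧
        b' ≫ n = ι' s ≫ y.app (d s) := by
      have hpo := h.hasPushout (a s) (ι s ≫ p.app (d s)) (ha s) (hA s) (hZ _)
      have hp := IsPushout.of_hasPushout (a s) (ι s ≫ p.app (d s))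
      have hc := h.cof_pushout _ _ _ _ (ha s) (hA s) (hZ _) hp
      have hws : a s ≫ ι' s ≫ y.app (d s) = (ι s ≫ p.app (d s)) ≫ r.app (d s) := by
        rw [← Category.assoc, ← hφ, Category.assoc, Category.assoc, ← NatTrans.comp_app, hw,
          NatTrans.comp_app]
      obtain ⟨N, c, n, hc', hn, hcn⟩ := h.factorization (hp.desc _ _ hws)
        (h.isCofibrant_of_cof (hZ _) hc)
      have hrn : (pushout.inr _ _ ≫ c) ≫ n = r.app (d s) := by
        rw [Category.assoc, hcn, hp.inr_desc]
      refine ⟨N, pushout.inr _ _ ≫ c, pushout.inl _ _ ≫ c, n, ⟨h.cof_comp _ _ hc hc',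
        W.of_postcomp _ _ hn ?_⟩, ?_, hrn, ?_⟩
      · rw [hrn]
        exact hr _
      · rw [← Category.assoc, ← hp.w, Category.assoc]
      · rw [Category.assoc, hcn, hp.inl_desc]
    choose N a' b' n ha' hab hn hbn using key
    -- The new cells are attached along identities of `Z.obj (d s)`, so that the enlargement of `Z`
    -- uses trivial cells only.
    obtain ⟨Z', t, β, ht, hβ, hdesc, -⟩ := h.exists_attach inf_le_left hZ d a' (fun s => hZ _) ha'
      (fun s => 𝟙 _)
    obtain ⟨r', hr', hβr⟩ := hdesc Y r n fun s => by simp [hn]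
    obtain ⟨s, hs⟩ := hF'.exists_desc fun s => b' s ≫ β s
    refine ⟨Z', t, r', s, ht, weq hZ ht hr hr', hr', hF'.hom_ext fun z => ?_,
      hF.hom_ext fun z => ?_⟩
    · rw [NatTrans.comp_app, ← Category.assoc, hs, Category.assoc, hβr, hbn]
    · rw [NatTrans.comp_app, NatTrans.comp_app, ← Category.assoc, hφ, Category.assoc, hs,
        ← Category.assoc, ← hab, Category.assoc, ← hβ, Category.id_comp, Category.assoc]
  | @pushout X X' Z₀ Z₀' f g g' f' hf hX hZ₀ hp ih =>
    obtain ⟨Z', t, r', s, ht, hWr, htr, hsr, hfs⟩ := ih hZ (g ≫ p) (g' ≫ y) r hr (by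
      rw [← Category.assoc, hp.w, Category.assoc, hw, Category.assoc]) weq
    have hw' : f ≫ s = g ≫ p ≫ t := by rw [hfs, Category.assoc]
    refine ⟨Z', t, r', hp.desc s (p ≫ t) hw', ht, hWr, htr, hp.hom_ext ?_ ?_, hp.inr_desc _ _ _⟩
    · rw [← Category.assoc, hp.inl_desc, hsr]
    · rw [← Category.assoc, hp.inr_desc, Category.assoc, htr, hw]
  | @comp X₀ X₁ X₂ f g hf hg ih₁ ih₂ =>
    obtain ⟨Z₁, t₁, r₁, s₁, ht₁, hr₁, htr₁, hsr₁, hfs₁⟩ := ih₁ hZ p (g ≫ y) r hr (by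
      rw [← Category.assoc, hw]) weq
    obtain ⟨Z₂, t₂, r₂, s₂, ht₂, hr₂, htr₂, hsr₂, hfs₂⟩ :=
      ih₂ (h.pcof_of_cell inf_le_left ht₁ hZ) s₁ y r₁ hr₁ hsr₁.symm weq
    refine ⟨Z₂, t₁ ≫ t₂, r₂, s₂, .comp ht₁ ht₂, hr₂, by rw [Category.assoc, htr₂, htr₁], hsr₂, ?_⟩
    rw [Category.assoc, hfs₂, ← Category.assoc, hfs₁, Category.assoc]
  | @seq X f X' ι hf hι ih =>
    -- A stage records an enlargement of `Z`, a partial lift on `X n`, and the weak equivalence to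
    -- `Y`; keeping these together lets each lift extend the previous one.
    let St (n : ℕ) := {q : (Z : D ⥤ M) × ((X n ⟶ Z) × (Z ⟶ Y)) //
      PCof Cof q.1 ∧ (∀ e, W (q.2.2.app e)) ∧ ι n ≫ y = q.2.1 ≫ q.2.2}
    have step (n : ℕ) (q : St n) : ∃ (q' : St (n + 1)) (t : q.1.1 ⟶ q'.1.1),
        Cell Cof (Cof ⊓ W) t ∧ t ≫ q'.1.2.2 = q.1.2.2 ∧ f n ≫ q'.1.2.1 = q.1.2.1 ≫ t := by
      obtain ⟨⟨Z, p, r⟩, hZ, hr, hpr⟩ := q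
      obtain ⟨Z', t, r', s, ht, hr', htr, hsr, hfs⟩ := ih n hZ p (ι (n + 1) ≫ y) r hr (by
        rw [← Category.assoc, hι.comm, hpr]) weq
      exact ⟨⟨⟨Z', s, r'⟩, h.pcof_of_cell inf_le_left ht hZ, hr', hsr.symm⟩, t, ht, htr, hfs⟩
    choose q' t ht htr hft using step
    let st (n : ℕ) : St n := Nat.rec ⟨⟨Z, p, r⟩, hZ, hr, hw⟩ (fun n q => q' n q) n
    let T (n : ℕ) : (st n).1.1 ⟶ (st (n + 1)).1.1 := t n (st n)
    have hT (n : ℕ) : Cell Cof (Cof ⊓ W) (T n) := ht _ _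
    have hTr (n : ℕ) : T n ≫ (st (n + 1)).1.2.2 = (st n).1.2.2 := htr _ _
    have hfT (n : ℕ) : f n ≫ (st (n + 1)).1.2.1 = (st n).1.2.1 ≫ T n := hft _ _
    obtain ⟨Z', κ, hκ⟩ := h.exists_isSeqColim_functor T hZ fun n e =>
      (h.cell_app inf_le_left (hT n) (st n).2.1 e).1
    obtain ⟨r', hr'⟩ := hκ.exists_desc (fun n => (st n).1.2.2) hTr
    obtain ⟨s, hs⟩ := hι.exists_desc (fun n => (st n).1.2.1 ≫ κ n) fun n => by
      rw [← Category.assoc, hfT, Category.assoc, hκ.comm]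
    have hcell : Cell Cof (Cof ⊓ W) (κ 0) := .seq hT hκ
    refine ⟨Z', κ 0, r', s, hcell, weq hZ hcell hr (hr' 0), hr' 0, hι.hom_ext fun n => ?_, hs 0⟩
    rw [← Category.assoc, hs, Category.assoc, hr']
    exact (st n).2.2.2.symm

/-- Relative left Kan extensions along cellular maps exist and are cellular. -/
lemma exists_extension (hJ : J ≤ Cof) {E : Type w} [SmallCategory E] (F : D ⥤ E) {X X' : D ⥤ M}
    {f : X ⟶ X'} (hf : Cell Cof J f) {V : E ⥤ M} (hV : PCof Cof V) (g : X ⟶ (res M F).obj V) :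
    ∃ (V' : E ⥤ M) (j : V ⟶ V') (g' : X' ⟶ (res M F).obj V'), Cell Cof J j ∧
      f ≫ g' = g ≫ (res M F).map j ∧
      (∀ (Y : E ⥤ M) (k : V ⟶ Y) (y : X' ⟶ (res M F).obj Y), f ≫ y = g ≫ (res M F).map k →
        ∃ l : V' ⟶ Y, j ≫ l = k ∧ g' ≫ (res M F).map l = y) ∧
      ∀ (Y : E ⥤ M) (l l' : V' ⟶ Y), j ≫ l = j ≫ l' →
        g' ≫ (res M F).map l = g' ≫ (res M F).map l' → l = l' := by
  induction hf generalizing V with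
  | @free S d A B a F₁ F₂ ι ι' φ hA ha hF hF' hφ =>
    -- Maps from a free cell at `d s` into a restricted diagram are maps from the free cell at
    -- `F.obj (d s)`, so the same cells are attached there.
    obtain ⟨V', t, β, ht, hβ, hdesc, hext, -⟩ := h.exists_attach hJ hV (fun s => F.obj (d s)) a
      hA ha (fun s => ι s ≫ g.app (d s))
    obtain ⟨g', hg'⟩ := hF'.exists_desc (Y := (res M F).obj V') β
    refine ⟨V', t, g', ht, hF.hom_ext fun s => ?_, fun Y k y hy => ?_, fun Y l l' hl hl' => ?_⟩
    · rw [NatTrans.comp_app, NatTrans.comp_app, ← Category.assoc, hφ, Category.assoc, hg', ← hβ,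
        Category.assoc]
      rfl
    · obtain ⟨l, hl, hl'⟩ := hdesc Y k (fun s => ι' s ≫ y.app (d s)) fun s => by
        rw [← Category.assoc, ← hφ, Category.assoc, Category.assoc]
        exact congrArg (ι s ≫ ·) (NatTrans.congr_app hy.symm (d s))
      refine ⟨l, hl, hF'.hom_ext fun s => ?_⟩
      rw [NatTrans.comp_app, ← Category.assoc, hg']
      exact hl' s
    · refine hext Y l l' hl fun s => ?_
      have := congrArg (ι' s ≫ ·) (NatTrans.congr_app hl' (d s))
      simp only [NatTrans.comp_app, ← Category.assoc, hg'] at this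
      exact this
  | @pushout X X' Z Z' f k₀ k₀' f' hf hX hZ hp ih =>
    obtain ⟨V', j, g₀, hj, hjg, hdesc, hext⟩ := ih hV (k₀ ≫ g)
    have hw : f ≫ g₀ = k₀ ≫ g ≫ (res M F).map j := by rw [hjg, Category.assoc]
    refine ⟨V', j, hp.desc g₀ _ hw, hj, hp.inr_desc _ _ _, fun Y k y hy => ?_,
      fun Y l l' hl hl' => hext Y l l' hl ?_⟩
    · obtain ⟨l, hl, hl'⟩ := hdesc Y k (k₀' ≫ y) (by
        rw [← Category.assoc, hp.w, Category.assoc, hy, Category.assoc])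
      refine ⟨l, hl, hp.hom_ext ?_ ?_⟩
      · rw [← Category.assoc, hp.inl_desc, hl']
      · rw [← Category.assoc, hp.inr_desc, hy, Category.assoc, ← (res M F).map_comp, hl]
    · have := congrArg (k₀' ≫ ·) hl'
      simpa only [← Category.assoc, hp.inl_desc] using this
  | @comp X₀ X₁ X₂ f₁ f₂ hf hg ih₁ ih₂ =>
    obtain ⟨V₁, j₁, g₁, hj₁, hjg₁, hd₁, he₁⟩ := ih₁ hV g
    obtain ⟨V₂, j₂, g₂, hj₂, hjg₂, hd₂, he₂⟩ := ih₂ (h.pcof_of_cell hJ hj₁ hV) g₁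
    refine ⟨V₂, j₁ ≫ j₂, g₂, .comp hj₁ hj₂, ?_, fun Y k y hy => ?_, fun Y l l' hl hl' => ?_⟩
    · rw [Category.assoc, hjg₂, ← Category.assoc, hjg₁, Category.assoc, (res M F).map_comp]
    · obtain ⟨l₁, hl₁, hl₁'⟩ := hd₁ Y k (f₂ ≫ y) (by rw [← Category.assoc, hy])
      obtain ⟨l₂, hl₂, hl₂'⟩ := hd₂ Y l₁ y hl₁'.symm
      exact ⟨l₂, by rw [Category.assoc, hl₂, hl₁], hl₂'⟩
    · refine he₂ Y l l' (he₁ Y _ _ (by simpa using hl) ?_) hl'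
      rw [(res M F).map_comp, (res M F).map_comp, ← Category.assoc, ← hjg₂, Category.assoc, hl',
        ← Category.assoc, hjg₂, Category.assoc]
  | @seq X f X' ι hf hι ih =>
    let St (n : ℕ) := {q : (V : E ⥤ M) × (X n ⟶ (res M F).obj V) // PCof Cof q.1}
    have step (n : ℕ) (q : St n) : ∃ (q' : St (n + 1)) (j : q.1.1 ⟶ q'.1.1), Cell Cof J j ∧
        f n ≫ q'.1.2 = q.1.2 ≫ (res M F).map j ∧
        (∀ (Y : E ⥤ M) (k : q.1.1 ⟶ Y) (y : X (n + 1) ⟶ (res M F).obj Y),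
          f n ≫ y = q.1.2 ≫ (res M F).map k →
          ∃ l : q'.1.1 ⟶ Y, j ≫ l = k ∧ q'.1.2 ≫ (res M F).map l = y) ∧
        ∀ (Y : E ⥤ M) (l l' : q'.1.1 ⟶ Y), j ≫ l = j ≫ l' →
          q'.1.2 ≫ (res M F).map l = q'.1.2 ≫ (res M F).map l' → l = l' := by
      obtain ⟨⟨V, g⟩, hV⟩ := q
      obtain ⟨V', j, g', hj, H⟩ := ih n hV g
      exact ⟨⟨⟨V', g'⟩, h.pcof_of_cell hJ hj hV⟩, j, hj, H⟩
    choose q' j hj hjg hd he using step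
    let st (n : ℕ) : St n := Nat.rec ⟨⟨V, g⟩, hV⟩ (fun n q => q' n q) n
    let T (n : ℕ) : (st n).1.1 ⟶ (st (n + 1)).1.1 := j n (st n)
    have hT (n : ℕ) : Cell Cof J (T n) := hj _ _
    have hTg (n : ℕ) : f n ≫ (st (n + 1)).1.2 = (st n).1.2 ≫ (res M F).map (T n) := hjg _ _
    obtain ⟨V', κ, hκ⟩ := h.exists_isSeqColim_functor T hV fun n e =>
      (h.cell_app hJ (hT n) (st n).2 e).1
    obtain ⟨g', hg'⟩ := hι.exists_desc (fun n => (st n).1.2 ≫ (res M F).map (κ n)) fun n => by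
      rw [← Category.assoc, hTg, Category.assoc, ← (res M F).map_comp, hκ.comm]
    refine ⟨V', κ 0, g', .seq hT hκ, hg' 0, fun Y k y hy => ?_, fun Y l l' hl hl' => ?_⟩
    · have next (n : ℕ) (l : {l : (st n).1.1 ⟶ Y // ι n ≫ y = (st n).1.2 ≫ (res M F).map l}) :
          ∃ l' : {l : (st (n + 1)).1.1 ⟶ Y // ι (n + 1) ≫ y = (st (n + 1)).1.2 ≫ (res M F).map l},
            T n ≫ l'.1 = l.1 := by
        obtain ⟨l', h₁, h₂⟩ := hd n (st n) Y l.1 (ι (n + 1) ≫ y) (by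
          rw [← Category.assoc, hι.comm]
          exact l.2)
        exact ⟨⟨l', h₂.symm⟩, h₁⟩
      choose nx hnx using next
      let ls (n : ℕ) : {l : (st n).1.1 ⟶ Y // ι n ≫ y = (st n).1.2 ≫ (res M F).map l} :=
        Nat.rec ⟨k, hy⟩ (fun n l => nx n l) n
      obtain ⟨l, hl⟩ := hκ.exists_desc (fun n => (ls n).1) fun n => hnx n (ls n)
      refine ⟨l, hl 0, hι.hom_ext fun n => ?_⟩
      rw [← Category.assoc, hg', Category.assoc, ← (res M F).map_comp, hl]
      exact (ls n).2.symm
    -- Agreement at stage `n` together with agreement on `X (n + 1)` gives agreement at stage `n +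
    -- 1`, by the uniqueness of that one extension.
    · refine hκ.hom_ext fun n => ?_
      induction n with
      | zero => exact hl
      | succ n hn =>
        refine he n (st n) Y _ _ ?_ ?_
        · change T n ≫ κ (n + 1) ≫ l = T n ≫ κ (n + 1) ≫ l'
          rw [← Category.assoc, ← Category.assoc, hκ.comm, hn]
        · have := congrArg (ι (n + 1) ≫ ·) hl'
          simp only [← Category.assoc, hg'] at this
          simp only [Category.assoc, ← (res M F).map_comp] at this
          exact this

end IsCofibrationCategory

end Cells

/-! ### Universal arrows -/

section Universal

variable {C₁ C₂ : Type*} [Category* C₁] [Category* C₂]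

/-- `g` is a universal arrow from `X` to the functor `G`. -/
def IsUniversalArrow (G : C₂ ⥤ C₁) {X : C₁} {V : C₂} (g : X ⟶ G.obj V) : Prop :=
  ∀ (Y : C₂) (y : X ⟶ G.obj Y), ∃! l : V ⟶ Y, g ≫ G.map l = y

variable {G : C₂ ⥤ C₁} {X : C₁} {V : C₂} {g : X ⟶ G.obj V}

lemma IsUniversalArrow.hom_ext (hg : IsUniversalArrow G g) {Y : C₂} {l l' : V ⟶ Y}
    (h : g ≫ G.map l = g ≫ G.map l') : l = l' :=
  (hg Y _).unique h rfl

lemma IsUniversalArrow.exists_iso (hg : IsUniversalArrow G g) {V' : C₂} {g' : X ⟶ G.obj V'}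
    (hg' : IsUniversalArrow G g') : ∃ e : V ≅ V', g ≫ G.map e.hom = g' := by
  obtain ⟨a, ha, -⟩ := hg _ g'
  obtain ⟨b, hb, -⟩ := hg' _ g
  refine ⟨⟨a, b, hg.hom_ext ?_, hg'.hom_ext ?_⟩, ha⟩
  · rw [G.map_comp, ← Category.assoc, ha, hb, G.map_id, Category.comp_id]
  · rw [G.map_comp, ← Category.assoc, hb, ha, G.map_id, Category.comp_id]

lemma IsUniversalArrow.leftAdjointObjIsDefined (hg : IsUniversalArrow G g) :
    G.leftAdjointObjIsDefined X := by
  have : (G ⋙ coyoneda.obj (Opposite.op X)).CorepresentableBy V :=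
    { homEquiv := fun {Y} => Equiv.ofBijective (fun l => g ≫ G.map l)
        ⟨fun l l' hl => hg.hom_ext hl, fun y => (hg Y y).exists⟩
      homEquiv_comp := fun f l => by
        change g ≫ G.map (l ≫ f) = (g ≫ G.map l) ≫ G.map f
        simp }
  exact this.isCorepresentable

end Universal

/-! ### Cellular diagrams as resolutions; homotopy colimits -/

section Cellular

variable {M : Type u} [Category.{v} M] {D : Type w} [SmallCategory D]

/-- Cellular diagrams: those admitting a cellular map from an initial diagram. -/
def IsCellular (Cof : MorphismProperty M) : ObjectProperty (D ⥤ M) := fun X =>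
  ∃ (I : D ⥤ M) (f : I ⟶ X), (∀ e, Nonempty (IsInitial (I.obj e))) ∧ Cell Cof Cof f

lemma hom_eq_of_isInitial {I : D ⥤ M} (hI : ∀ e, Nonempty (IsInitial (I.obj e))) {X : D ⥤ M}
    (a b : I ⟶ X) : a = b := by
  ext e
  exact (hI e).some.hom_ext _ _

lemma nonempty_hom_of_isInitial {I : D ⥤ M} (hI : ∀ e, Nonempty (IsInitial (I.obj e)))
    (X : D ⥤ M) : Nonempty (I ⟶ X) :=
  ⟨{ app := fun e => (hI e).some.to _, naturality := fun e _ _ => (hI e).some.hom_ext _ _ }⟩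

variable {W Cof : MorphismProperty M}

lemma IsCellular.of_cell {X Y : D ⥤ M} (hX : IsCellular Cof X) {f : X ⟶ Y}
    (hf : Cell Cof Cof f) : IsCellular Cof Y := by
  obtain ⟨I, g, hI, hg⟩ := hX
  exact ⟨I, g ≫ f, hI, .comp hg hf⟩

namespace IsCofibrationCategory

variable (h : IsCofibrationCategory.{w} W Cof)

include h

lemma pcof_of_isInitial {I : D ⥤ M} (hI : ∀ e, Nonempty (IsInitial (I.obj e))) : PCof Cof I :=
  fun e => h.isCofibrant_of_isInitial (hI e).some

lemma pcof_of_isCellular {X : D ⥤ M} (hX : IsCellular Cof X) : PCof Cof X := by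
  obtain ⟨I, f, hI, hf⟩ := hX
  exact h.pcof_of_cell le_rfl hf (h.pcof_of_isInitial hI)

variable (D) in
lemma exists_isInitial_functor : ∃ I : D ⥤ M, ∀ e, Nonempty (IsInitial (I.obj e)) := by
  obtain ⟨I, hI, -⟩ := h.exists_initial
  exact ⟨(Functor.const D).obj I, fun _ => hI⟩

lemma hasTwoOutOfThreeProperty_functorCategory :
    (W.functorCategory D).HasTwoOutOfThreeProperty := by
  have := h.two_out_of_three
  exact
    { comp_mem := fun f g hf hg e => W.comp_mem _ _ (hf e) (hg e)
      of_postcomp := fun f g hg hfg e => W.of_postcomp (f.app e) (g.app e) (hg e) (hfg e)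
      of_precomp := fun f g hf hfg e => W.of_precomp (f.app e) (g.app e) (hf e) (hfg e) }

/-- Cellular diagrams are resolving for the pointwise weak equivalences. -/
lemma isResolving_isCellular : IsResolving (W.functorCategory D) (IsCellular (D := D) Cof) where
  exists_resolution X := by
    obtain ⟨I, hI⟩ := h.exists_isInitial_functor D
    obtain ⟨f⟩ := nonempty_hom_of_isInitial hI X
    obtain ⟨Z, i, r, hi, hr, -⟩ := h.exists_cell_factorization (h.pcof_of_isInitial hI) f
    exact ⟨Z, r, ⟨I, i, hI, hi⟩, hr⟩
  exists_cospan {P P' X} a b hP hP' hb := by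
    obtain ⟨I, f, hI, hf⟩ := hP
    obtain ⟨p⟩ := nonempty_hom_of_isInitial hI P'
    obtain ⟨Z, t, r, s, ht, hr, htr, hsr, -⟩ := h.exists_lift hf (h.pcof_of_isCellular hP') p a b hb
      (hom_eq_of_isInitial hI _ _)
    exact ⟨Z, s, t, r, hP'.of_cell (ht.mono inf_le_left), hr, hsr, htr⟩
  exists_cylinder {P Z Y} a b r hP hZ hr hab := by
    have hPc := h.pcof_of_isCellular hP
    have hP₀ := hP
    obtain ⟨I, f, hI, hf⟩ := hP
    have hIc := h.pcof_of_isInitial hI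
    -- The source of `f` is initial, so this pushout is the coproduct of two copies of `P`;
    -- factoring its fold map gives a cylinder.
    have := hasPushout_functor f f
      (h.hasPushout_app hIc hPc fun e => (h.cell_app le_rfl hf hIc e).1)
    have hp := IsPushout.of_hasPushout f f
    have hN : IsCellular Cof (pushout f f) := hP₀.of_cell (.pushout hf hIc hPc hp)
    obtain ⟨C, c, s, hc, hs, hcs⟩ := h.exists_cell_factorization (h.pcof_of_isCellular hN)
      (hp.desc (𝟙 P) (𝟙 P) rfl)
    -- The constant homotopy from `a ≫ r` to `b ≫ r` is lifted through `r`; the lift exists only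
    -- after enlarging `Z` to `Z'`.
    obtain ⟨Z', t, r', l, ht, -, -, -, hcl⟩ := h.exists_lift hc (h.pcof_of_isCellular hZ)
      (hp.desc a b (hom_eq_of_isInitial hI _ _)) (s ≫ a ≫ r) r hr (hp.hom_ext
        (by simp [reassoc_of% hcs]) (by simp [reassoc_of% hcs, hab]))
    refine ⟨C, Z', pushout.inl f f ≫ c, pushout.inr f f ≫ c, s, t, l, hN.of_cell hc,
      hZ.of_cell (ht.mono inf_le_left), hs, fun e =>
        (h.cell_app inf_le_left ht (h.pcof_of_isCellular hZ) e).2 inf_le_right, ?_, ?_, ?_, ?_⟩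
    all_goals simp [hcs, hcl]

/-- A functor on cellular diagrams that inverts trivial cellular maps inverts all pointwise weak
equivalences. -/
lemma isIso_of_inverts_trivial {H : Type*} [Category* H]
    (Ψ : (IsCellular (D := D) Cof).FullSubcategory ⥤ H)
    (hΨ : ∀ {P P' : (IsCellular (D := D) Cof).FullSubcategory} (t : P ⟶ P'),
      Cell Cof (Cof ⊓ W) t.hom → IsIso (Ψ.map t))
    {P P' : (IsCellular (D := D) Cof).FullSubcategory} (f : P ⟶ P')
    (hf : W.functorCategory D f.hom) : IsIso (Ψ.map f) := by
  have := h.hasTwoOutOfThreeProperty_functorCategory (D := D)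
  have := h.two_out_of_three
  -- Lifting the identity of `P'` through `f` writes `f` as a trivial cellular map followed by a map
  -- with a section, and two out of three makes the section a weak equivalence.
  have fac {P P' : (IsCellular (D := D) Cof).FullSubcategory} (f : P ⟶ P')
      (hf : W.functorCategory D f.hom) : ∃ (Q : (IsCellular (D := D) Cof).FullSubcategory)
        (t : P ⟶ Q) (r : Q ⟶ P') (s : P' ⟶ Q), IsIso (Ψ.map t) ∧ t ≫ r = f ∧ s ≫ r = 𝟙 P' ∧
        W.functorCategory D s.hom := by
    obtain ⟨I, g, hI, hg⟩ := P'.property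
    obtain ⟨p⟩ := nonempty_hom_of_isInitial hI P.obj
    obtain ⟨Z, t, r, s, ht, hr, htr, hsr, -⟩ := h.exists_lift hg (h.pcof_of_isCellular P.property)
      p (𝟙 P'.obj) f.hom hf (hom_eq_of_isInitial hI _ _)
    let Q : (IsCellular (D := D) Cof).FullSubcategory :=
      ⟨Z, P.property.of_cell (ht.mono inf_le_left)⟩
    refine ⟨Q, ObjectProperty.homMk t, ObjectProperty.homMk r, ObjectProperty.homMk s,
      hΨ (P' := Q) (ObjectProperty.homMk t) ht, ?_, ?_, ?_⟩
    · ext1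
      exact htr
    · ext1
      exact hsr
    · refine (W.functorCategory D).of_postcomp s r (show W.functorCategory D r from hr) ?_
      rw [hsr]
      exact fun e => h.weq_of_isIso _ (inferInstanceAs (IsIso (𝟙 _)))
  -- Factoring the section `s` in the same way gives `Ψ.map s` a one-sided inverse on the side
  -- opposite to `Ψ.map r`. So `Ψ.map s` is invertible, and with it `Ψ.map r`.
  obtain ⟨Q, t, r, s, ht, rfl, hsr, hs⟩ := fac f hf
  obtain ⟨Q₂, t₂, r₂, s₂, ht₂, hs₂, hsr₂, -⟩ := fac s hs
  have e₁ : Ψ.map s ≫ Ψ.map r = 𝟙 _ := by rw [← Ψ.map_comp, hsr, Ψ.map_id]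
  have e₂ : Ψ.map s₂ ≫ Ψ.map r₂ = 𝟙 _ := by rw [← Ψ.map_comp, hsr₂, Ψ.map_id]
  have e₃ : Ψ.map s = Ψ.map t₂ ≫ Ψ.map r₂ := by rw [← Ψ.map_comp, hs₂]
  have : IsIso (Ψ.map s) := by
    have : IsSplitMono (Ψ.map s) := ⟨⟨⟨Ψ.map r, e₁⟩⟩⟩
    have : IsSplitEpi (Ψ.map s) := ⟨⟨⟨Ψ.map s₂ ≫ inv (Ψ.map t₂), by
      rw [e₃, Category.assoc, IsIso.inv_hom_id_assoc, e₂]⟩⟩⟩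
    exact isIso_of_epi_of_isSplitMono _
  have : IsIso (Ψ.map r) := by
    rw [IsIso.eq_inv_of_hom_inv_id e₁]
    infer_instance
  rw [Ψ.map_comp]
  infer_instance

variable {E : Type w} [SmallCategory E] (F : D ⥤ E)

/-- Extend along the cellular map from an initial diagram: the conditions on the initial parts are
vacuous, so the relative universal property becomes absolute. -/
lemma exists_universalArrow {X : D ⥤ M} (hX : IsCellular Cof X) :
    ∃ (V : E ⥤ M) (g : X ⟶ (res M F).obj V), IsUniversalArrow (res M F) g ∧ PCof Cof V := by
  obtain ⟨I, f, hI, hf⟩ := hX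
  obtain ⟨I', hI'⟩ := h.exists_isInitial_functor E
  obtain ⟨g₀⟩ := nonempty_hom_of_isInitial hI ((res M F).obj I')
  obtain ⟨V, j, g, hj, -, hd, he⟩ := h.exists_extension le_rfl F hf (h.pcof_of_isInitial hI') g₀
  refine ⟨V, g, fun Y y => ?_, h.pcof_of_cell le_rfl hj (h.pcof_of_isInitial hI')⟩
  obtain ⟨k⟩ := nonempty_hom_of_isInitial hI' Y
  obtain ⟨l, -, hl⟩ := hd Y k y (hom_eq_of_isInitial hI _ _)
  exact ⟨l, hl, fun l' hl' => he Y _ _ (hom_eq_of_isInitial hI' _ _) (hl'.trans hl.symm)⟩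

lemma isCellular_le : IsCellular Cof ≤ (res M F).leftAdjointObjIsDefined := fun _ hX => by
  obtain ⟨V, g, hg, -⟩ := h.exists_universalArrow F hX
  exact hg.leftAdjointObjIsDefined

/-- Left Kan extension takes trivial cellular maps to pointwise weak equivalences. -/
lemma weq_of_trivial_cell {X X' : D ⥤ M} (hX : IsCellular Cof X) {t : X ⟶ X'}
    (ht : Cell Cof (Cof ⊓ W) t) {V V' : E ⥤ M} {g : X ⟶ (res M F).obj V}
    {g' : X' ⟶ (res M F).obj V'} (hg : IsUniversalArrow (res M F) g)
    (hg' : IsUniversalArrow (res M F) g') (m : V ⟶ V') (hm : g ≫ (res M F).map m = t ≫ g') :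
    W.functorCategory E m := by
  have := h.two_out_of_three
  obtain ⟨V₀, g₀, hg₀, hV₀⟩ := h.exists_universalArrow F hX
  obtain ⟨e₀, -⟩ := hg₀.exists_iso hg
  have hV : PCof Cof V := fun d => h.isCofibrant_of_iso (e₀.app d) (hV₀ d)
  -- Extending `V` along `t` produces another universal arrow out of `X'`. Hence `m` is, up to
  -- isomorphism, the trivial cellular map `j`.
  obtain ⟨V₁, j, g₁, hj, hjg, hd, he⟩ := h.exists_extension inf_le_left F ht hV g
  have hg₁ : IsUniversalArrow (res M F) g₁ := fun Y y => by
    obtain ⟨k, hk, -⟩ := hg Y (t ≫ y)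
    obtain ⟨l, hl, hl'⟩ := hd Y k y hk.symm
    refine ⟨l, hl', fun l' hl'' => he Y _ _ (hg.hom_ext ?_) (hl''.trans hl'.symm)⟩
    rw [(res M F).map_comp, (res M F).map_comp, ← Category.assoc, ← Category.assoc, ← hjg,
      Category.assoc, Category.assoc, hl', hl'']
  obtain ⟨e, he⟩ := hg₁.exists_iso hg'
  have hme : m = j ≫ e.hom := hg.hom_ext (by
    rw [hm, (res M F).map_comp, ← Category.assoc, ← hjg, Category.assoc, he])
  intro d
  rw [hme]
  exact W.comp_mem _ _ ((h.cell_app inf_le_left hj hV d).2 inf_le_right)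
    (h.weq_of_isIso _ (inferInstanceAs (IsIso (e.app d).hom)))

/-- Existence of homotopy colimits in a cofibration category, for arbitrary models of the
localizations and of the domain of the colimit functor. -/
theorem exists_homotopyColimit {H₁ H₂ C₀ : Type*} [Category* H₁] [Category* H₂] [Category* C₀]
    (Q₁ : (D ⥤ M) ⥤ H₁) [Q₁.IsLocalization (W.functorCategory D)]
    (Q₂ : (E ⥤ M) ⥤ H₂) [Q₂.IsLocalization (W.functorCategory E)]
    (G' : H₂ ⥤ H₁) (e : res M F ⋙ Q₁ ≅ Q₂ ⋙ G') (i : C₀ ⥤ D ⥤ M) [i.Full] (T : C₀ ⥤ E ⥤ M)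
    (η : i ⟶ T ⋙ res M F) (hη : ∀ X, IsUniversalArrow (res M F) (η.app X))
    (k : (res M F).PartialLeftAdjointSource ⥤ C₀)
    (κ : k ⋙ i ≅ (res M F).leftAdjointObjIsDefined.ι) :
    ∃ (L : H₁ ⥤ H₂) (ε : (i ⋙ Q₁) ⋙ L ⟶ T ⋙ Q₂) (adj : L ⊣ G'), L.IsRightKanExtension ε ∧
      ∀ X : C₀, adj.unit.app (Q₁.obj (i.obj X)) ≫ G'.map (ε.app X) =
        Q₁.map (η.app X) ≫ e.hom.app (T.obj X) := by
  have := h.hasTwoOutOfThreeProperty_functorCategory (D := D)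
  let k' : (IsCellular (D := D) Cof).FullSubcategory ⥤ C₀ :=
    ObjectProperty.ιOfLE (h.isCellular_le F) ⋙ k
  let κ' : k' ⋙ i ≅ (IsCellular Cof).ι :=
    Functor.isoWhiskerLeft (ObjectProperty.ιOfLE (h.isCellular_le F)) κ
  refine exists_derived_adjunction h.isResolving_isCellular Q₁ Q₂ (res M F) G' e i T η
    hη k' κ' (W.functorCategory E) fun {P P'} f hf => ?_
  -- By the Brown-type lemma only trivial cellular maps need checking, and on these left Kan
  -- extension is already known to give weak equivalences.
  refine h.isIso_of_inverts_trivial (k' ⋙ T ⋙ Q₂) (fun {P P'} t ht => ?_) f hf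
  have huniv (P : (IsCellular (D := D) Cof).FullSubcategory) : IsUniversalArrow (res M F)
      (κ'.inv.app P ≫ η.app (k'.obj P) : P.obj ⟶ (res M F).obj (T.obj (k'.obj P))) := fun Y y => by
    obtain ⟨l, hl, hl'⟩ := hη (k'.obj P) Y (κ'.hom.app P ≫ y)
    refine ⟨l, ?_, fun l' hl'' => hl' l' ?_⟩
    · dsimp only at hl ⊢
      rw [Category.assoc, hl, κ'.inv_hom_id_app_assoc]
    · dsimp only at hl'' ⊢
      rw [← hl'', Category.assoc, κ'.hom_inv_id_app_assoc]
  refine Localization.inverts Q₂ (W.functorCategory E) _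
    (h.weq_of_trivial_cell F P.property ht (huniv P) (huniv P') (T.map (k'.map t)) ?_)
  have h₁ : t.hom ≫ κ'.inv.app P' = κ'.inv.app P ≫ i.map (k'.map t) := κ'.inv.naturality t
  have h₂ : i.map (k'.map t) ≫ η.app (k'.obj P') =
    η.app (k'.obj P) ≫ (res M F).map (T.map (k'.map t)) := η.naturality (k'.map t)
  rw [Category.assoc, ← h₂, ← Category.assoc, ← h₁, Category.assoc]

end IsCofibrationCategory

end Cellular

/-! ### Duality between fibration and cofibration categories -/

section Duality

variable {M : Type u} [Category.{v} M] {W Fib : MorphismProperty M}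

lemma isCofibrant_op_iff {A : Mᵒᵖ} : IsCofibrant Fib.op A ↔ IsFibrant Fib A.unop := by
  constructor
  · rintro ⟨I, hI, hc⟩
    refine ⟨I.unop, terminalUnopOfInitial hI, ?_⟩
    rwa [(terminalUnopOfInitial hI).hom_ext ((terminalUnopOfInitial hI).from A.unop)
      (hI.to A).unop]
  · rintro ⟨T, hT, hc⟩
    refine ⟨Opposite.op T, initialOpOfTerminal hT, ?_⟩
    rw [(initialOpOfTerminal hT).hom_ext ((initialOpOfTerminal hT).to A) (hT.from A.unop).op]
    exact hc

namespace IsFibrationCategory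

variable (h : IsFibrationCategory.{w} W Fib)

include h

lemma isFibrant_of_iso {A B : M} (e : A ≅ B) (hB : IsFibrant Fib B) : IsFibrant Fib A := by
  have he := h.fib_of_isIso e.hom inferInstance hB
  obtain ⟨T, hT, hf⟩ := hB
  refine ⟨T, hT, ?_⟩
  rw [hT.hom_ext (hT.from A) (e.hom ≫ hT.from B)]
  exact h.fib_comp _ _ he hf

lemma isFibrant_of_fib {A B : M} {f : A ⟶ B} (hB : IsFibrant Fib B) (hf : Fib f) :
    IsFibrant Fib A := by
  obtain ⟨T, hT, hc⟩ := hB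
  refine ⟨T, hT, ?_⟩
  rw [hT.hom_ext (hT.from A) (f ≫ hT.from B)]
  exact h.fib_comp _ _ hf hc

/-- The opposite of a fibration category is a cofibration category. -/
lemma op : IsCofibrationCategory.{w} W.op Fib.op where
  exists_initial := by
    obtain ⟨T, ⟨hT⟩, hc⟩ := h.exists_terminal
    exact ⟨Opposite.op T, ⟨initialOpOfTerminal hT⟩, isCofibrant_op_iff.2 hc⟩
  cof_comp f g hf hg := h.fib_comp _ _ hg hf
  weq_of_isIso f hf := h.weq_of_isIso _ inferInstance
  cof_of_isIso f hf hA := h.fib_of_isIso _ inferInstance (isCofibrant_op_iff.1 hA)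
  two_out_of_three := by
    have := h.two_out_of_three
    infer_instance
  hasPushout i g hi hA hC := by
    have := h.hasPullback i.unop g.unop hi (isCofibrant_op_iff.1 hA) (isCofibrant_op_iff.1 hC)
    exact (IsPullback.of_hasPullback i.unop g.unop).op.flip.hasPushout
  cof_pushout i g k j hi hA hC hp :=
    h.fib_pullback i.unop g.unop k.unop j.unop hi (isCofibrant_op_iff.1 hA)
      (isCofibrant_op_iff.1 hC) hp.unop.flip
  weq_pushout i g k j hi hw hA hC hp :=
    h.weq_pullback i.unop g.unop k.unop j.unop hi hw (isCofibrant_op_iff.1 hA)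
      (isCofibrant_op_iff.1 hC) hp.unop.flip
  factorization f hA := by
    obtain ⟨X, s, f', hs, hf', hsf⟩ := h.factorization f.unop (isCofibrant_op_iff.1 hA)
    exact ⟨Opposite.op X, f'.op, s.op, hf', hs, Quiver.Hom.unop_inj hsf⟩
  coproduct {I} A B f hA hf := by
    have := h.two_out_of_three
    obtain ⟨_, _, hPB, hPA, hF, hW⟩ := h.product (fun i => (B i).unop) (fun i => (A i).unop)
      (fun i => (f i).unop) (fun i => isCofibrant_op_iff.1 (hA i)) hf
    have hcA : IsColimit (Cofan.mk (f := A) _ fun i => (Pi.π (fun i => (A i).unop) i).op) :=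
      Fan.IsLimit.op (productIsProduct fun i => (A i).unop)
    have hcB : IsColimit (Cofan.mk (f := B) _ fun i => (Pi.π (fun i => (B i).unop) i).op) :=
      Fan.IsLimit.op (productIsProduct fun i => (B i).unop)
    have hA' : HasCoproduct A := ⟨⟨_, hcA⟩⟩
    have hB' : HasCoproduct B := ⟨⟨_, hcB⟩⟩
    -- The axiom speaks of the chosen coproducts in `Mᵒᵖ`; these isomorphisms compare them with the
    -- opposites of the chosen products in `M`.
    let eA := (coproductIsCoproduct A).coconePointUniqueUpToIso hcA
    let eB := hcB.coconePointUniqueUpToIso (coproductIsCoproduct B)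
    have heA (i : I) : Sigma.ι A i ≫ eA.hom = (Pi.π (fun i => (A i).unop) i).op :=
      (coproductIsCoproduct A).comp_coconePointUniqueUpToIso_hom hcA ⟨i⟩
    have heB (i : I) : (Pi.π (fun i => (B i).unop) i).op ≫ eB.hom = Sigma.ι B i :=
      hcB.comp_coconePointUniqueUpToIso_hom (coproductIsCoproduct B) ⟨i⟩
    have key : Limits.Sigma.map f =
        eA.hom ≫ (Limits.Pi.map fun i => (f i).unop).op ≫ eB.hom := by
      refine Sigma.hom_ext _ _ fun i => ?_
      rw [← Category.assoc (Sigma.ι A i) eA.hom, heA, ← Category.assoc, ← op_comp, Pi.map_π,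
        op_comp, Category.assoc, heB]
      simp
    have hcB : IsFibrant Fib (∐ B).unop := h.isFibrant_of_iso eB.unop hPB
    have hcA : IsFibrant Fib (∐ A).unop := h.isFibrant_of_iso eA.symm.unop hPA
    refine ⟨hA', hB', isCofibrant_op_iff.2 hcA, isCofibrant_op_iff.2 hcB, ?_, fun H => ?_⟩
    · rw [key]
      exact h.fib_comp _ _ (h.fib_comp _ _ (h.fib_of_isIso eB.hom.unop inferInstance hPB) hF)
        (h.fib_of_isIso eA.hom.unop inferInstance hcA)
    · rw [key]
      exact W.comp_mem _ _ (W.comp_mem _ _ (h.weq_of_isIso eB.hom.unop inferInstance) (hW H))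
        (h.weq_of_isIso eA.hom.unop inferInstance)
  sequence A h₀ hA := by
    have := h.two_out_of_three
    obtain ⟨_, hF, hW⟩ := h.sequence A.leftOp (isCofibrant_op_iff.1 h₀) hA
    have hc : HasColimit A := ⟨⟨_, isColimitCoconeOfConeLeftOp A (limit.isLimit A.leftOp)⟩⟩
    have key : (colimit.ι A 0).unop =
        (limitLeftOpIsoUnopColimit A).inv ≫ limit.π A.leftOp (Opposite.op 0) :=
      (limitLeftOpIsoUnopColimit_inv_comp_π A (Opposite.op 0)).symm
    have hl : IsFibrant Fib (limit A.leftOp) := h.isFibrant_of_fib (isCofibrant_op_iff.1 h₀) hF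
    refine ⟨hc, ?_, fun H => ?_⟩
    · change Fib (colimit.ι A 0).unop
      rw [key]
      exact h.fib_comp _ _ (h.fib_of_isIso _ inferInstance hl) hF
    · change W (colimit.ι A 0).unop
      rw [key]
      exact W.comp_mem _ _ (h.weq_of_isIso _ inferInstance) (hW H)

end IsFibrationCategory

end Duality

/-! ### Universal maps and the homotopy colimit theorem -/

section Main

variable {M : Type u} [Category.{v} M] (W : MorphismProperty M)
  {D₁ D₂ : Type w} [SmallCategory D₁] [SmallCategory D₂] (F : D₁ ⥤ D₂)

variable (M) in
/-- The universal maps `X ⟶ u^* (colim^u X)` are natural. -/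
noncomputable def colimUnitNatTrans : iColim M F ⟶ colimAlong M F ⋙ res M F where
  app X := colimUnit F X
  naturality X Y f := by
    change f.hom ≫ (res M F).partialLeftAdjointHomEquiv (𝟙 _) =
      (res M F).partialLeftAdjointHomEquiv (𝟙 _) ≫
        (res M F).map ((res M F).partialLeftAdjointMap f)
    rw [← Functor.partialLeftAdjointHomEquiv_comp, Category.id_comp,
      Functor.partialLeftAdjointHomEquiv_map]

lemma isUniversalArrow_colimUnit (X : ColimDomain M F) :
    IsUniversalArrow (res M F) (colimUnit F X) := fun Y y => by
  have key (l : (res M F).partialLeftAdjointObj X ⟶ Y) :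
      colimUnit F X ≫ (res M F).map l = (res M F).partialLeftAdjointHomEquiv l :=
    ((res M F).partialLeftAdjointHomEquiv_comp (𝟙 _) l).symm.trans
      (congrArg _ (Category.id_comp l))
  exact ⟨(res M F).partialLeftAdjointHomEquiv.symm y,
    (key _).trans (Equiv.apply_symm_apply _ y), fun l hl =>
      (Equiv.eq_symm_apply _).2 ((key l).symm.trans hl)⟩

variable (M) in
/-- The universal maps `u^* (lim^u X) ⟶ X` are natural. -/
noncomputable def limCounitNatTrans : limAlong M F ⋙ res M F ⟶ iLim M F where
  app X := limCounit F X
  naturality X Y f := by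
    change (res M F).map ((res M F).partialRightAdjointMap f) ≫
      (res M F).partialRightAdjointHomEquiv (𝟙 _) =
        (res M F).partialRightAdjointHomEquiv (𝟙 _) ≫ f.hom
    rw [← Functor.partialRightAdjointHomEquiv_comp, Category.comp_id,
      Functor.partialRightAdjointHomEquiv_map]

lemma existsUnique_limCounit (X : LimDomain M F) (Y : D₂ ⥤ M)
    (y : (res M F).obj Y ⟶ (iLim M F).obj X) :
    ∃! l : Y ⟶ (limAlong M F).obj X, (res M F).map l ≫ limCounit F X = y := by
  have key (l : Y ⟶ (res M F).partialRightAdjointObj X) :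
      (res M F).map l ≫ limCounit F X = (res M F).partialRightAdjointHomEquiv l :=
    ((res M F).partialRightAdjointHomEquiv_comp (𝟙 _) l).symm.trans
      (congrArg _ (Category.comp_id l))
  exact ⟨(res M F).partialRightAdjointHomEquiv.symm y,
    (key _).trans (Equiv.apply_symm_apply _ y), fun l hl =>
      (Equiv.eq_symm_apply _).2 ((key l).symm.trans hl)⟩

variable {W}

/-- Here the model for the domain of `colim^u` is the full domain itself, so the comparison data are
identities. Uniqueness of Kan extensions carries the adjunction to an arbitrary homotopy colimit. -/
theorem IsCofibrationCategory.homotopyColimit {Cof : MorphismProperty M}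
    (h : IsCofibrationCategory.{w} W Cof) :
    (∃ (L : Ho W D₁ ⥤ Ho W D₂) (ε : (iColim M F ⋙ γ W D₁) ⋙ L ⟶ colimAlong M F ⋙ γ W D₂),
      IsHomotopyColimit W F L ε) ∧
    ∀ (L : Ho W D₁ ⥤ Ho W D₂) (ε : (iColim M F ⋙ γ W D₁) ⋙ L ⟶ colimAlong M F ⋙ γ W D₂),
      IsHomotopyColimit W F L ε →
      ∃ adj : L ⊣ hoRes W F, ∀ X : ColimDomain M F,
        adj.unit.app ((γ W D₁).obj X.obj) ≫ (hoRes W F).map (ε.app X) =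
          (γ W D₁).map (colimUnit F X) ≫ (resIso W F).hom.app ((colimAlong M F).obj X) := by
  obtain ⟨L, ε, adj, hL, hadj⟩ := h.exists_homotopyColimit F (γ W D₁) (γ W D₂) (hoRes W F)
    (resIso W F) (iColim M F) (colimAlong M F) (colimUnitNatTrans M F)
    (isUniversalArrow_colimUnit F) (𝟭 _) (Iso.refl _)
  refine ⟨⟨L, ε, hL⟩, fun L' ε' hL' => ?_⟩
  have : L'.IsRightKanExtension ε' := hL'
  exact exists_adjunction_of_isRightKanExtension (γ W D₁) (γ W D₂) (res M F) (hoRes W F)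
    (resIso W F) (iColim M F) (colimAlong M F) (colimUnitNatTrans M F) adj hadj

end Main

/-! ### Kan extensions under passage to opposites -/

section OppositeKanExtensions

variable {C₀ H₁ H₂ : Type*} [Category* C₀] [Category* H₁] [Category* H₂]
  {p : C₀ ⥤ H₁} {t : C₀ ⥤ H₂} {R : H₁ ⥤ H₂} {ν : t ⟶ p ⋙ R}

/-- Taking opposites reverses natural transformations, hence exchanges the initial and terminal
universal properties; this brings the homotopy limit back from the opposite category. -/
lemma isLeftKanExtension_of_op
    (h : R.op.IsRightKanExtension (L := p.op) (F := t.op) (NatTrans.op ν)) :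
    R.IsLeftKanExtension ν := by
  let δ (E : p.LeftExtension t) : E.right.op ⟶ R.op :=
    R.op.liftOfIsRightKanExtension (L := p.op) (F := t.op) (NatTrans.op ν) E.right.op
      (NatTrans.op E.hom)
  have hδ (E : p.LeftExtension t) :
      Functor.whiskerLeft p.op (δ E) ≫ NatTrans.op ν = NatTrans.op E.hom :=
    R.op.liftOfIsRightKanExtension_fac (L := p.op) (F := t.op) (NatTrans.op ν) E.right.op
      (NatTrans.op E.hom)
  refine ⟨⟨IsInitial.ofUniqueHom (fun E => StructuredArrow.homMk (NatTrans.unop (δ E))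
    (congrArg NatTrans.unop (hδ E))) fun E f => ?_⟩⟩
  ext1
  exact congrArg NatTrans.unop (R.op.hom_ext_of_isRightKanExtension (L := p.op) (F := t.op)
    (NatTrans.op ν) (NatTrans.op f.right) (δ E)
    ((congrArg NatTrans.op (StructuredArrow.w f)).trans (hδ E).symm))

lemma isRightKanExtension_op [R.IsLeftKanExtension ν] :
    R.op.IsRightKanExtension (L := p.op) (F := t.op) (NatTrans.op ν) := by
  refine ⟨⟨IsTerminal.ofUniqueHom (fun E => CostructuredArrow.homMk
    (NatTrans.op (R.descOfIsLeftKanExtension ν E.left.unop (NatTrans.unop E.hom)) : E.left ⟶ R.op)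
      ?_) ?_⟩⟩
  · ext X
    exact congrArg Quiver.Hom.op (R.descOfIsLeftKanExtension_fac_app ν E.left.unop
      (NatTrans.unop E.hom) X.unop)
  · intro E f
    ext1
    have : NatTrans.unop f.left = R.descOfIsLeftKanExtension ν E.left.unop (NatTrans.unop E.hom) := by
      refine R.hom_ext_of_isLeftKanExtension ν _ _ ?_
      rw [Functor.descOfIsLeftKanExtension_fac]
      ext X
      exact congrArg Quiver.Hom.unop (NatTrans.congr_app (CostructuredArrow.w f) (Opposite.op X))
    exact congrArg NatTrans.op this

end OppositeKanExtensions

/-! ### The homotopy limit theorem by duality -/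

section Main

variable {M : Type u} [Category.{v} M] (W : MorphismProperty M)
  {D₁ D₂ : Type w} [SmallCategory D₁] [SmallCategory D₂] (F : D₁ ⥤ D₂)

/-- The localization functor of the category of `D`-diagrams, as a functor on `Dᵒᵖ`-diagrams in
the opposite category. -/
noncomputable abbrev opγ (D : Type w) [SmallCategory D] : (Dᵒᵖ ⥤ Mᵒᵖ) ⥤ (Ho W D)ᵒᵖ :=
  Functor.opInv D M ⋙ (γ W D).op

/-- The equivalence between `Dᵒᵖ ⥤ Mᵒᵖ` and `(D ⥤ M)ᵒᵖ` matches the pointwise weak equivalences, and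
the opposite of a localization is a localization. Thus `(Ho W D)ᵒᵖ` serves as the homotopy category
of the opposite diagrams. -/
instance isLocalization_opγ (D : Type w) [SmallCategory D] :
    (opγ W D).IsLocalization (W.op.functorCategory Dᵒᵖ) := by
  refine Functor.IsLocalization.of_equivalence_source (γ W D).op (W.functorCategory D).op _ _
    (Functor.opUnopEquiv D M) (fun X Y f hf => ?_) (fun X Y f hf => ?_) (Iso.refl _)
  · exact MorphismProperty.le_isoClosure _ _ fun d => hf d.unop
  · have : (W.functorCategory D).op ((Functor.opInv D M).map f) := fun d => hf (Opposite.op d)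
    exact Localization.inverts (γ W D).op (W.functorCategory D).op _ this

/-- Restriction of diagrams in the opposite category commutes with localization. -/
noncomputable def opResIso : res Mᵒᵖ F.op ⋙ opγ W D₁ ≅ opγ W D₂ ⋙ (hoRes W F).op :=
  Functor.isoWhiskerLeft (Functor.opInv D₂ M) (NatIso.op (resIso W F).symm)

variable (M) in
/-- The universal maps `u^* (lim^u X) ⟶ X` in the opposite category. -/
noncomputable def opLimCounitNatTrans : (iLim M F).op ⋙ Functor.opHom D₁ M ⟶
    ((limAlong M F).op ⋙ Functor.opHom D₂ M) ⋙ res Mᵒᵖ F.op :=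
  Functor.whiskerRight (NatTrans.op (limCounitNatTrans M F)) (Functor.opHom D₁ M)

lemma isUniversalArrow_opLimCounit (X : (LimDomain M F)ᵒᵖ) :
    IsUniversalArrow (res Mᵒᵖ F.op) ((opLimCounitNatTrans M F).app X) := fun Y y => by
  obtain ⟨l, hl, hl'⟩ := existsUnique_limCounit F X.unop Y.unop (NatTrans.unop y)
  exact ⟨NatTrans.op l, congrArg NatTrans.op hl, fun l' h => congrArg NatTrans.op
    (hl' (NatTrans.unop l') (congrArg NatTrans.unop h))⟩

/-- A universal arrow out of `X` in the opposite category, read backwards, is a universal arrow into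
`X.unop`. It ensures that every diagram with a colimit in `Mᵒᵖ` lies in the domain of `lim^u`. -/
lemma rightAdjointObjIsDefined_unop {X : D₁ᵒᵖ ⥤ Mᵒᵖ}
    (hX : (res Mᵒᵖ F.op).leftAdjointObjIsDefined X) :
    (res M F).rightAdjointObjIsDefined X.unop := by
  have hu := isUniversalArrow_colimUnit F.op ⟨X, hX⟩
  let V := (colimAlong Mᵒᵖ F.op).obj ⟨X, hX⟩
  let g : (res M F).obj V.unop ⟶ X.unop := NatTrans.unop (colimUnit F.op ⟨X, hX⟩)
  have : ((res M F).op ⋙ yoneda.obj X.unop).RepresentableBy V.unop :=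
    { homEquiv := fun {Y} => Equiv.ofBijective (fun l => (res M F).map l ≫ g)
        ⟨fun l l' hl => congrArg NatTrans.unop (hu.hom_ext (l := NatTrans.op l)
            (l' := NatTrans.op l') (congrArg NatTrans.op hl)), fun y => by
          obtain ⟨l, hl⟩ := (hu Y.op (NatTrans.op y)).exists
          exact ⟨NatTrans.unop l, congrArg NatTrans.unop hl⟩⟩
      homEquiv_comp := fun f l => by
        change (res M F).map (f ≫ l) ≫ g = (res M F).map f ≫ (res M F).map l ≫ g
        simp }
  exact this.isRepresentable

variable (M) in
/-- Colimits along `u` in the opposite category are limits along `u`. -/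
def colimDomainToLimDomain : ColimDomain Mᵒᵖ F.op ⥤ (LimDomain M F)ᵒᵖ where
  obj X := Opposite.op ⟨X.obj.unop, rightAdjointObjIsDefined_unop F X.property⟩
  map f := (ObjectProperty.homMk (NatTrans.unop f.hom)).op

variable {W}

/-- The colimit theorem is applied to `Mᵒᵖ` with the opposite homotopy categories as localizations
and the opposite of the domain of `lim^u`. Reversing arrows turns the unit identity into the counit
identity. -/
theorem IsFibrationCategory.homotopyLimit {Fib : MorphismProperty M}
    (h : IsFibrationCategory.{w} W Fib) :
    (∃ (R : Ho W D₁ ⥤ Ho W D₂) (ν : limAlong M F ⋙ γ W D₂ ⟶ (iLim M F ⋙ γ W D₁) ⋙ R),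
      IsHomotopyLimit W F R ν) ∧
    ∀ (R : Ho W D₁ ⥤ Ho W D₂) (ν : limAlong M F ⋙ γ W D₂ ⟶ (iLim M F ⋙ γ W D₁) ⋙ R),
      IsHomotopyLimit W F R ν →
      ∃ adj : hoRes W F ⊣ R, ∀ X : LimDomain M F,
        (hoRes W F).map (ν.app X) ≫ adj.counit.app ((γ W D₁).obj X.obj) =
          (resIso W F).inv.app ((limAlong M F).obj X) ≫ (γ W D₁).map (limCounit F X) := by
  have : ((iLim M F).op ⋙ Functor.opHom D₁ M).Full :=
    have : (Functor.opHom D₁ M).Full := (Functor.opUnopEquiv D₁ M).full_functor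
    inferInstance
  obtain ⟨L, ε, adj, hL, hadj⟩ := h.op.exists_homotopyColimit F.op (opγ W D₁) (opγ W D₂)
    (hoRes W F).op (opResIso W F) ((iLim M F).op ⋙ Functor.opHom D₁ M)
    ((limAlong M F).op ⋙ Functor.opHom D₂ M) (opLimCounitNatTrans M F)
    (isUniversalArrow_opLimCounit F) (colimDomainToLimDomain M F) (Iso.refl _)
  refine ⟨⟨L.unop, NatTrans.unop (F := (iLim M F ⋙ γ W D₁).op ⋙ L)
    (G := (limAlong M F ⋙ γ W D₂).op) ε, ?_⟩, fun R ν hR => ?_⟩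
  · exact isLeftKanExtension_of_op (p := iLim M F ⋙ γ W D₁) (t := limAlong M F ⋙ γ W D₂) hL
  · have : R.IsLeftKanExtension ν := hR
    have hR' : R.op.IsRightKanExtension (L := ((iLim M F).op ⋙ Functor.opHom D₁ M) ⋙ opγ W D₁)
      (F := ((limAlong M F).op ⋙ Functor.opHom D₂ M) ⋙ opγ W D₂) (NatTrans.op ν) :=
        isRightKanExtension_op
    obtain ⟨adj', hadj'⟩ := exists_adjunction_of_isRightKanExtension (opγ W D₁) (opγ W D₂)
      (res Mᵒᵖ F.op) (hoRes W F).op (opResIso W F) ((iLim M F).op ⋙ Functor.opHom D₁ M)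
      ((limAlong M F).op ⋙ Functor.opHom D₂ M) (opLimCounitNatTrans M F) (L' := R.op)
      (ε' := NatTrans.op ν) adj hadj
    exact ⟨adj'.unop, fun X => congrArg Quiver.Hom.unop (hadj' (Opposite.op X))⟩

end Main

end ABC

theorem mainTheorem2 {M : Type u} [Category.{v} M] (W : MorphismProperty M)
    {D₁ D₂ : Type w} [SmallCategory D₁] [SmallCategory D₂] (F : D₁ ⥤ D₂) :
    (∀ Cof : MorphismProperty M, ABC.IsCofibrationCategory.{w} W Cof →
      (∃ (L : ABC.Ho W D₁ ⥤ ABC.Ho W D₂)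
        (ε : (ABC.iColim M F ⋙ ABC.γ W D₁) ⋙ L ⟶ ABC.colimAlong M F ⋙ ABC.γ W D₂),
        ABC.IsHomotopyColimit W F L ε) ∧
      ∀ (L : ABC.Ho W D₁ ⥤ ABC.Ho W D₂)
        (ε : (ABC.iColim M F ⋙ ABC.γ W D₁) ⋙ L ⟶ ABC.colimAlong M F ⋙ ABC.γ W D₂),
        ABC.IsHomotopyColimit W F L ε →
        ∃ adj : L ⊣ ABC.hoRes W F, ∀ X : ABC.ColimDomain M F,
          adj.unit.app ((ABC.γ W D₁).obj X.obj) ≫ (ABC.hoRes W F).map (ε.app X) =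
            (ABC.γ W D₁).map (ABC.colimUnit F X) ≫
              (ABC.resIso W F).hom.app ((ABC.colimAlong M F).obj X)) ∧
    (∀ Fib : MorphismProperty M, ABC.IsFibrationCategory.{w} W Fib →
      (∃ (R : ABC.Ho W D₁ ⥤ ABC.Ho W D₂)
        (ν : ABC.limAlong M F ⋙ ABC.γ W D₂ ⟶ (ABC.iLim M F ⋙ ABC.γ W D₁) ⋙ R),
        ABC.IsHomotopyLimit W F R ν) ∧
      ∀ (R : ABC.Ho W D₁ ⥤ ABC.Ho W D₂)
        (ν : ABC.limAlong M F ⋙ ABC.γ W D₂ ⟶ (ABC.iLim M F ⋙ ABC.γ W D₁) ⋙ R),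
        ABC.IsHomotopyLimit W F R ν →
        ∃ adj : ABC.hoRes W F ⊣ R, ∀ X : ABC.LimDomain M F,
          (ABC.hoRes W F).map (ν.app X) ≫ adj.counit.app ((ABC.γ W D₁).obj X.obj) =
            (ABC.resIso W F).inv.app ((ABC.limAlong M F).obj X) ≫
              (ABC.γ W D₁).map (ABC.limCounit F X)) := by
  exact ⟨fun Cof h => h.homotopyColimit F, fun Fib h => h.homotopyLimit F⟩
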